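/- Letters are positive integers, logarithms are to base $2$, and $\mathcal M$ is the class of all monotonic distributions $\theta=(\theta_1\ge\theta_2\ge\cdots\ge 0)$, $\sum_j\theta_j=1$. For a binary prefix code on blocks $x^n$ of $n$ letters with length function $L_n$, and an i.i.d. source $\theta\in\mathcal M$ with finite entropy $H_\theta=-\sum_j\theta_j\log\theta_j$, the per-symbol redundancy is $R_n(L_n,\theta)=\frac1n E_\theta L_n(X^n)-H_\theta$. A sequence of such codes is called universal for $\mathcal M$ if it does not depend on $\theta$ and $R_n(L_n,\theta)\le o(1)$ as $n\to\infty$ for every $\theta\in\mathcal M$ of finite entropy. There exists a sequence of codes $(L^*_n)_{n\ge1}$, universal for $\mathcal M$, with the following property. Let $\gamma>0$ and let $\theta$ be the distribution with probabilities $$\frac{a}{i(\log i)^{2+\gamma}},\qquad i=2,3,\ldots,$$ where $a$ is the normalizing factor (so that, with letters relabelled by rank, i.e. $\theta_j=\frac{a}{(j+1)(\log (j+1))^{2+\gamma}}$ for $j\ge 1$, we have $\theta\in\mathcal M$). Then $H_\theta<\infty$, and for every $\varepsilon>0$ there is $n_0=n_0(\gamma,\varepsilon)$ such that for all $n\ge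 n_0$ $$R_n(L^*_n,\theta)\le(1+\varepsilon)\,\frac{n^{\frac{\gamma+4}{3\gamma+4}}(\log n)^2}{2n}.$$ The codes $L^*_n$ do not depend on $\theta$, $\gamma$ or $\varepsilon$. -/

import Mathlib

open Filter
open scoped ENNReal

namespace MonotoneCoding

noncomputable section

/-- The class of monotonic probability distributions. Letters are identified with their rank in
the (known) order of probabilities, counted from `0`: `θ j` is the probability of the
`(j + 1)`-st letter. Finite alphabets are included, with trailing zeros. -/
def MonotoneSources : Set (ℕ → ℝ) :=
  {θ | (∀ j, 0 ≤ θ j) ∧ Antitone θ ∧ HasSum θ 1}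

/-- A binary prefix code for blocks of `n` letters: no codeword is a prefix of the codeword of
another block. -/
structure PrefixCode (n : ℕ) where
  /-- The codeword of a block. -/
  encode : (Fin n → ℕ) → List Bool
  prefix_free : ∀ x y : Fin n → ℕ, encode x <+: encode y → x = y

/-- The length function `L(xⁿ)` of a code, in bits. -/
def PrefixCode.len {n : ℕ} (C : PrefixCode n) (x : Fin n → ℕ) : ℕ := (C.encode x).length

/-- The probability of the block `xⁿ` under the i.i.d. source `θ`. -/
def blockProb (θ : ℕ → ℝ) {n : ℕ} (x : Fin n → ℕ) : ℝ := ∏ t, θ (x t)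

/-- The expected length `E_θ L(Xⁿ)`, in bits; it may be infinite. -/
def expectedLength (θ : ℕ → ℝ) {n : ℕ} (C : PrefixCode n) : ℝ≥0∞ :=
  ∑' x : Fin n → ℕ, ENNReal.ofReal (blockProb θ x) * (C.len x : ℝ≥0∞)

/-- The per-letter entropy `H_θ(X)`, in bits; it may be infinite. -/
def entropy (θ : ℕ → ℝ) : ℝ≥0∞ :=
  ∑' j : ℕ, ENNReal.ofReal (-(θ j * Real.logb 2 (θ j)))

/-- The average per-letter redundancy `R_n(L, θ) = E_θ L(Xⁿ) / n - H_θ(X)`. It is meaningful for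
`n ≥ 1` and sources of finite entropy; it is `⊤` if the expected length is then infinite. -/
def redundancy (θ : ℕ → ℝ) {n : ℕ} (C : PrefixCode n) : EReal :=
  ((expectedLength θ C / (n : ℝ≥0∞) : ℝ≥0∞) : EReal) - (entropy θ : EReal)

/-- A sequence of block codes is universal for monotonic sources if its per-letter redundancy is
`o(1)` for every monotonic source of finite entropy (the code does not depend on the source). -/
def IsUniversal (C : (n : ℕ) → PrefixCode n) : Prop :=
  ∀ θ ∈ MonotoneSources, entropy θ ≠ ⊤ →
    ∀ δ : ℝ, 0 < δ → ∀ᶠ n : ℕ in atTop, redundancy θ (C n) ≤ (δ : EReal)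

/-- `θ` is the slowly decaying distribution with probabilities `a / (i (log i)^(2 + γ))`,
`i = 2, 3, …`, the letter `i` having rank `j = i - 2`; membership of `θ` in `MonotoneSources`
makes `a` the normalizing factor. -/
def IsSlowSource (γ : ℝ) (θ : ℕ → ℝ) : Prop :=
  ∃ a : ℝ, ∀ j : ℕ, θ j = a / (((j : ℝ) + 2) * (Real.logb 2 ((j : ℝ) + 2)) ^ (2 + γ))

end

end MonotoneCoding

namespace MonotoneCoding

/-! The code is a Bayesian mixture. A histogram is a piecewise constant distribution given by
finitely many integer blocks (width, mass), with a fixed polynomial tail. There are countably many,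
and they carry an explicit prior. Coding a block of letters by its mixture probability costs, for
every histogram at once, at most the ideal length under that histogram plus the negative log prior
plus 2 bits (`histCode_len_le`). The histogram may thus be chosen in the analysis, knowing `θ` and
`n`, while the code knows neither. The redundancy is at most the divergence from `θ` to the
histogram plus the description length over `n` (`redundancy_histCode_le`).

Universality takes one fixed histogram of arbitrarily small divergence: singleton blocks up to a
large letter. The tail is affordable because monotonicity gives `θ j ≤ 1 / (j + 1)`, so finite
entropy makes the sum of `θ j * log (j + 2)` finite.

For the slow source the blocks grow by a factor `2 ^ η`. Replacing `θ` by block averages costs only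
order `η ^ 2`, since the first-order term cancels (`sum_block_cost_le`). With `G` blocks the tail
costs about `(η G) ^ (-γ) * log n`, and the description about `G * (η G + log n) / n`. Balancing
gives `n ^ ((γ + 4) / (3 γ + 4)) * log n / n` up to a constant: one logarithm better than needed,
and that logarithm absorbs the constant. -/

/-! ### Sums over tuples and over lists. -/

theorem tsum_pi_prod {α : Type*} {n : ℕ} (g : Fin n → α → ℝ≥0∞) :
    ∑' x : Fin n → α, ∏ t, g t (x t) = ∏ t, ∑' a, g t a := by
  induction n with
  | zero => simp
  | succ n ih =>
    rw [← (Fin.consEquiv (fun _ : Fin (n + 1) => α)).tsum_eq, ENNReal.tsum_prod',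
      Fin.prod_univ_succ, ← ih (fun t => g t.succ), ← ENNReal.tsum_mul_right]
    refine tsum_congr fun a => ?_
    rw [← ENNReal.tsum_mul_left]
    refine tsum_congr fun x => ?_
    simp [Fin.consEquiv, Fin.prod_univ_succ]

theorem tsum_list {α : Type*} (F : List α → ℝ≥0∞) :
    ∑' l, F l = ∑' n : ℕ, ∑' x : Fin n → α, F (List.ofFn x) := by
  rw [← (List.equivSigmaTuple (α := α)).symm.tsum_eq, ENNReal.tsum_sigma']
  rfl

/-! ### Shannon–Fano–Elias coding. -/

/-- The `k`-th digit of the binary expansion of the fractional part of `r`. -/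
noncomputable def binaryDigit (r : ℝ) (k : ℕ) : Bool := decide (⌊r * 2 ^ (k + 1)⌋ % 2 = 1)

theorem floor_mul_two_pow_eq_of_binaryDigit_eq {r s : ℝ} (h0 : ⌊r⌋ = ⌊s⌋) {l : ℕ}
    (h : ∀ k < l, binaryDigit r k = binaryDigit s k) : ⌊r * 2 ^ l⌋ = ⌊s * 2 ^ l⌋ := by
  induction l with
  | zero => simpa using h0
  | succ l ih =>
    have ih' := ih fun k hk => h k (hk.trans (Nat.lt_succ_self l))
    have hl := h l (Nat.lt_succ_self l)
    have key : ∀ r : ℝ, ⌊r * 2 ^ (l + 1)⌋ / 2 = ⌊r * 2 ^ l⌋ := fun r => by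
      have := Int.floor_div_natCast (r * 2 ^ (l + 1)) 2
      rw [← Nat.cast_two (R := ℤ), ← this]
      congr 1
      push_cast
      rw [pow_succ]; ring
    have h1 := key r
    have h2 := key s
    simp only [binaryDigit, decide_eq_decide] at hl
    omega

/-- The Shannon–Fano–Elias code of a subprobability on a countable set. -/
theorem exists_prefix_code {α : Type*} [Encodable α] (P : α → ℝ≥0∞) (hP : ∀ x, P x ≠ 0)
    (hsum : ∑' x, P x ≤ 1) :
    ∃ enc : α → List Bool, (∀ x y, enc x <+: enc y → x = y) ∧
      ∀ x, ((enc x).length : ℝ) ≤ 2 - Real.logb 2 (P x).toReal := by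
  classical
  have hne : ∑' x, P x ≠ ⊤ := ne_top_of_le_ne_top ENNReal.one_ne_top hsum
  have hfin : ∀ x, P x ≠ ⊤ := fun x => ENNReal.ne_top_of_tsum_ne_top hne x
  set p : α → ℝ := fun x => (P x).toReal with hp
  have hpos : ∀ x, 0 < p x := fun x => ENNReal.toReal_pos (hP x) (hfin x)
  have hps : Summable p := ENNReal.summable_toReal hne
  have htot : ∑' x, p x ≤ 1 := by
    rw [← ENNReal.tsum_toReal_eq hfin]
    exact ENNReal.toReal_le_of_le_ofReal zero_le_one (by simpa using hsum)
  let below : α → Set α := fun x => {y | Encodable.encode y < Encodable.encode x}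
  let F : α → ℝ := fun x => ∑' y, (below x).indicator p y
  have hind : ∀ s : Set α, Summable (s.indicator p) := fun s => hps.indicator s
  have hstep : ∀ x y, Encodable.encode x < Encodable.encode y → F x + p x ≤ F y := by
    intro x y hxy
    have h1 : F x + p x = ∑' z, ((below x).indicator p z + ({x} : Set α).indicator p z) := by
      rw [(hind _).tsum_add (hind _)]
      congr 1
      rw [tsum_eq_single x]
      · simp
      · intro z hz; simp [hz]
    rw [h1]
    refine ((hind _).add (hind _)).tsum_le_tsum (fun z => ?_) (hind _)
    by_cases hz : z = x
    · subst hz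
      simp [below, hxy]
    · by_cases hb : z ∈ below x
      · have : z ∈ below y := lt_trans hb hxy
        simp [hb, this, hz]
      · simp only [hb, hz, Set.indicator_of_notMem, Set.mem_singleton_iff, not_false_eq_true,
          add_zero]
        exact Set.indicator_nonneg (fun z _ => (hpos z).le) z
  have hF0 : ∀ x, 0 ≤ F x := fun x =>
    tsum_nonneg fun z => Set.indicator_nonneg (fun z _ => (hpos z).le) z
  have hF1 : ∀ x, F x + p x ≤ 1 := by
    intro x
    have h1 : F x + p x = ∑' z, ((below x).indicator p z + ({x} : Set α).indicator p z) := by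
      rw [(hind _).tsum_add (hind _)]
      congr 1
      rw [tsum_eq_single x]
      · simp
      · intro z hz; simp [hz]
    rw [h1]
    refine (((hind _).add (hind _)).tsum_le_tsum (fun z => ?_) hps).trans htot
    by_cases hz : z = x
    · subst hz
      simp [below]
    · simp only [hz, Set.indicator_of_notMem, Set.mem_singleton_iff, not_false_eq_true, add_zero]
      exact Set.indicator_le_self' (fun z _ => (hpos z).le) z
  -- The intervals `[F x, F x + p x)` are disjoint, so two midpoints differ by at least `(p x + p y)
  -- / 2`. The extra digit in `len` makes `2 ^ (-len x) ≤ p x / 2`; agreement on `len x` digits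
  -- would put the midpoints closer than `p x / 2`.
  let mid : α → ℝ := fun x => F x + p x / 2
  let len : α → ℕ := fun x => ⌈-Real.logb 2 (p x)⌉₊ + 1
  have hfloor : ∀ x, ⌊mid x⌋ = 0 := fun x => by
    rw [Int.floor_eq_zero_iff]
    constructor
    · have := hF0 x; have := hpos x; simp only [mid]; linarith
    · have := hF1 x; have := hpos x; simp only [mid]; linarith
  have hlen : ∀ x, 1 ≤ p x / 2 * 2 ^ len x := by
    intro x
    have h1 : -Real.logb 2 (p x) ≤ (⌈-Real.logb 2 (p x)⌉₊ : ℝ) := Nat.le_ceil _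
    have h2 : (p x)⁻¹ ≤ 2 ^ (⌈-Real.logb 2 (p x)⌉₊) := by
      rw [← Real.logb_inv, Real.logb_le_iff_le_rpow (by norm_num) (inv_pos.2 (hpos x)),
        Real.rpow_natCast] at h1
      simpa using h1
    have h3 : 1 ≤ p x * 2 ^ (⌈-Real.logb 2 (p x)⌉₊) := by
      rwa [inv_le_iff_one_le_mul₀' (hpos x)] at h2
    simp only [len, pow_succ]
    linarith
  have hclose : ∀ x y, (∀ k < len x, binaryDigit (mid x) k = binaryDigit (mid y) k) →
      |mid x - mid y| < p x / 2 := by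
    intro x y h
    have h1 := Int.abs_sub_lt_one_of_floor_eq_floor
      (floor_mul_two_pow_eq_of_binaryDigit_eq ((hfloor x).trans (hfloor y).symm) h)
    rw [← sub_mul, abs_mul, abs_of_pos (a := (2 : ℝ) ^ len x) (by positivity)] at h1
    exact lt_of_mul_lt_mul_right (h1.trans_le (hlen x)) (by positivity)
  refine ⟨fun x => (List.range (len x)).map (binaryDigit (mid x)), ?_, ?_⟩
  · intro x y hxy
    have hd : ∀ k < len x, binaryDigit (mid x) k = binaryDigit (mid y) k := by
      intro k hk
      have hle := hxy.length_le
      simp only [List.length_map, List.length_range] at hle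
      have := hxy.getElem (i := k) (by simpa using hk)
      simpa using this
    have hc := hclose x y hd
    rw [abs_lt] at hc
    by_contra hne
    rcases lt_or_gt_of_ne (fun h => hne (Encodable.encode_injective h)) with h | h
    · have := hstep x y h
      have := hpos y
      simp only [mid] at hc
      linarith [hc.1]
    · have := hstep y x h
      have := hpos y
      simp only [mid] at hc
      linarith [hc.2]
  · intro x
    simp only [List.length_map, List.length_range, len]
    have hp1 : p x ≤ 1 := by linarith [hF0 x, hF1 x]
    have h0 : 0 ≤ -Real.logb 2 (p x) := by
      have := Real.logb_nonpos (b := 2) (by norm_num) (hpos x).le hp1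
      linarith
    have := Nat.ceil_lt_add_one h0
    push_cast
    linarith

/-! ### Histogram distributions and their prior. -/

/-- The probabilities `1 / ((k + 1) (k + 2))` on the natural numbers. -/
noncomputable def integerProb (k : ℕ) : ℝ := 1 / (((k : ℝ) + 1) * ((k : ℝ) + 2))

theorem integerProb_pos (k : ℕ) : 0 < integerProb k := by
  unfold integerProb; positivity

theorem hasSum_integerProb : HasSum integerProb 1 := by
  rw [hasSum_iff_tendsto_nat_of_nonneg fun k => (integerProb_pos k).le]
  have h : ∀ n : ℕ, ∑ k ∈ Finset.range n, integerProb k = 1 - 1 / ((n : ℝ) + 1) := by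
    intro n
    induction n with
    | zero => simp
    | succ n ih =>
      rw [Finset.sum_range_succ, ih, integerProb]
      push_cast
      field_simp
      ring
  simp_rw [h]
  simpa using (tendsto_one_div_add_atTop_nhds_zero_nat (𝕜 := ℝ)).const_sub 1

theorem tsum_ofReal_integerProb : ∑' k, ENNReal.ofReal (integerProb k) = 1 := by
  rw [← ENNReal.ofReal_tsum_of_nonneg (fun k => (integerProb_pos k).le)
    hasSum_integerProb.summable, hasSum_integerProb.tsum_eq, ENNReal.ofReal_one]

theorem neg_logb_integerProb_le (k : ℕ) :
    -Real.logb 2 (integerProb k) ≤ 2 * Real.logb 2 ((k : ℝ) + 2) := by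
  rw [integerProb, one_div, Real.logb_inv, neg_neg, two_mul,
    ← Real.logb_mul (by positivity) (by positivity)]
  refine Real.logb_le_logb_of_le (by norm_num) (by positivity) ?_
  gcongr
  norm_num

/-- The unnormalized piecewise constant distribution whose consecutive blocks have the sizes
`w + 1` and the masses `c + 1`, for `(w, c)` in the list; the rest of the alphabet gets mass one,
spread as `integerProb`. -/
noncomputable def histWeight : List (ℕ × ℕ) → ℕ → ℝ
  | [], j => integerProb j
  | (w, c) :: l, j => if j < w + 1 then ((c : ℝ) + 1) / ((w : ℝ) + 1) else histWeight l (j - (w + 1))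

/-- The total mass of `histWeight`. -/
noncomputable def histTotal : List (ℕ × ℕ) → ℝ
  | [] => 1
  | (_, c) :: l => ((c : ℝ) + 1) + histTotal l

/-- The histogram distribution described by a list of blocks. -/
noncomputable def histProb (l : List (ℕ × ℕ)) (j : ℕ) : ℝ := histWeight l j / histTotal l

/-- The prior weight of a histogram. -/
noncomputable def histPrior : List (ℕ × ℕ) → ℝ
  | [] => 1 / 2
  | (w, c) :: l => 1 / 2 * (integerProb w * integerProb c) * histPrior l

theorem histWeight_pos (l : List (ℕ × ℕ)) (j : ℕ) : 0 < histWeight l j := by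
  induction l generalizing j with
  | nil => exact integerProb_pos j
  | cons a l ih =>
    rw [histWeight]
    split_ifs
    · positivity
    · exact ih _

theorem histTotal_pos (l : List (ℕ × ℕ)) : 0 < histTotal l := by
  induction l with
  | nil => exact one_pos
  | cons a l ih => rw [histTotal]; positivity

theorem histProb_pos (l : List (ℕ × ℕ)) (j : ℕ) : 0 < histProb l j :=
  div_pos (histWeight_pos l j) (histTotal_pos l)

theorem histPrior_pos (l : List (ℕ × ℕ)) : 0 < histPrior l := by
  induction l with
  | nil => norm_num [histPrior]
  | cons a l ih =>
    have := integerProb_pos a.1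
    have := integerProb_pos a.2
    rw [histPrior]; positivity

theorem hasSum_histWeight (l : List (ℕ × ℕ)) : HasSum (histWeight l) (histTotal l) := by
  induction l with
  | nil => exact hasSum_integerProb
  | cons a l ih =>
    rw [← hasSum_nat_add_iff' (a.1 + 1)]
    have h1 : ∑ i ∈ Finset.range (a.1 + 1), histWeight (a :: l) i = (a.2 : ℝ) + 1 := by
      rw [Finset.sum_congr rfl (g := fun _ => ((a.2 : ℝ) + 1) / ((a.1 : ℝ) + 1))]
      · rw [Finset.sum_const, Finset.card_range, nsmul_eq_mul]
        push_cast
        field_simp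
      · intro i hi
        rw [histWeight, if_pos (Finset.mem_range.1 hi)]
    have h2 : (fun n => histWeight (a :: l) (n + (a.1 + 1))) = histWeight l := by
      funext n
      rw [histWeight, if_neg (by omega), Nat.add_sub_cancel]
    rw [h1, h2, histTotal, add_sub_cancel_left]
    exact ih

theorem hasSum_histProb (l : List (ℕ × ℕ)) : HasSum (histProb l) 1 := by
  have := (hasSum_histWeight l).div_const (histTotal l)
  rwa [div_self (histTotal_pos l).ne'] at this

theorem histProb_le_one (l : List (ℕ × ℕ)) (j : ℕ) : histProb l j ≤ 1 :=
  le_hasSum (hasSum_histProb l) j fun i _ => (histProb_pos l i).le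

theorem tsum_ofReal_histProb (l : List (ℕ × ℕ)) : ∑' j, ENNReal.ofReal (histProb l j) = 1 := by
  rw [← ENNReal.ofReal_tsum_of_nonneg (fun k => (histProb_pos l k).le)
    (hasSum_histProb l).summable, (hasSum_histProb l).tsum_eq, ENNReal.ofReal_one]

theorem ofReal_histPrior_ofFn {n : ℕ} (x : Fin n → ℕ × ℕ) :
    ENNReal.ofReal (histPrior (List.ofFn x)) = 2⁻¹ ^ (n + 1) *
      ∏ t, ENNReal.ofReal (integerProb (x t).1) * ENNReal.ofReal (integerProb (x t).2) := by
  have h2 : ENNReal.ofReal (1 / 2) = 2⁻¹ := by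
    rw [one_div, ENNReal.ofReal_inv_of_pos two_pos, ENNReal.ofReal_ofNat]
  induction n with
  | zero => simp [histPrior]
  | succ n ih =>
    have h1 := (integerProb_pos (x 0).1).le
    have h3 := (integerProb_pos (x 0).2).le
    rw [List.ofFn_succ, histPrior, ENNReal.ofReal_mul (by positivity), ih, Fin.prod_univ_succ,
      ENNReal.ofReal_mul (by norm_num), ENNReal.ofReal_mul h1, h2]
    ring

/-- Under the prior the length of the list is geometric with ratio `1 / 2`, and its entries are
independent with law `integerProb`. -/
theorem tsum_ofReal_histPrior : ∑' l, ENNReal.ofReal (histPrior l) = 1 := by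
  rw [tsum_list]
  simp_rw [ofReal_histPrior_ofFn, ENNReal.tsum_mul_left]
  have h : ∑' a : ℕ × ℕ, ENNReal.ofReal (integerProb a.1) * ENNReal.ofReal (integerProb a.2)
      = 1 := by
    rw [ENNReal.tsum_prod (f := fun a b => ENNReal.ofReal (integerProb a) *
      ENNReal.ofReal (integerProb b))]
    simp_rw [ENNReal.tsum_mul_left, tsum_ofReal_integerProb, mul_one, tsum_ofReal_integerProb]
  have h' : ∀ n : ℕ, ∑' x : Fin n → ℕ × ℕ, ∏ t, ENNReal.ofReal (integerProb (x t).1) *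
      ENNReal.ofReal (integerProb (x t).2) = 1 := by
    intro n
    rw [tsum_pi_prod (fun _ (a : ℕ × ℕ) => ENNReal.ofReal (integerProb a.1) *
      ENNReal.ofReal (integerProb a.2))]
    simp [h]
  simp_rw [h', mul_one]
  rw [ENNReal.tsum_geometric_add_one, ENNReal.one_sub_inv_two, inv_inv,
    ENNReal.inv_mul_cancel two_ne_zero ENNReal.ofNat_ne_top]

theorem histPrior_le_one (l : List (ℕ × ℕ)) : histPrior l ≤ 1 := by
  have := ENNReal.le_tsum (f := fun l => ENNReal.ofReal (histPrior l)) l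
  rw [tsum_ofReal_histPrior] at this
  simpa using this

/-! ### The mixture code and its redundancy. -/

/-- The mixture of all histogram distributions, on blocks of `n` letters. -/
noncomputable def histMixture (n : ℕ) (x : Fin n → ℕ) : ℝ≥0∞ :=
  ∑' l, ENNReal.ofReal (histPrior l) * ∏ t, ENNReal.ofReal (histProb l (x t))

theorem tsum_histMixture (n : ℕ) : ∑' x, histMixture n x = 1 := by
  unfold histMixture
  rw [ENNReal.tsum_comm]
  simp_rw [ENNReal.tsum_mul_left]
  have h : ∀ l, ∑' x : Fin n → ℕ, ∏ t, ENNReal.ofReal (histProb l (x t)) = 1 := fun l => by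
    rw [tsum_pi_prod (fun _ a => ENNReal.ofReal (histProb l a))]
    simp [tsum_ofReal_histProb]
  simp_rw [h, mul_one, tsum_ofReal_histPrior]

theorem ofReal_le_histMixture {n : ℕ} (x : Fin n → ℕ) (l : List (ℕ × ℕ)) :
    ENNReal.ofReal (histPrior l * ∏ t, histProb l (x t)) ≤ histMixture n x := by
  rw [ENNReal.ofReal_mul (histPrior_pos l).le,
    ENNReal.ofReal_prod_of_nonneg fun t _ => (histProb_pos l (x t)).le]
  exact ENNReal.le_tsum l

theorem histMixture_ne_zero {n : ℕ} (x : Fin n → ℕ) : histMixture n x ≠ 0 := by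
  refine (lt_of_lt_of_le ?_ (ofReal_le_histMixture x [])).ne'
  exact ENNReal.ofReal_pos.2 (mul_pos (histPrior_pos _) (Finset.prod_pos fun t _ => histProb_pos _ _))

theorem exists_histCode (n : ℕ) : ∃ C : PrefixCode n, ∀ x, (C.len x : ℝ) ≤
    2 - Real.logb 2 (histMixture n x).toReal := by
  obtain ⟨enc, h1, h2⟩ := exists_prefix_code (histMixture n) histMixture_ne_zero
    (tsum_histMixture n).le
  exact ⟨⟨enc, h1⟩, h2⟩

/-- The Shannon–Fano–Elias code of the mixture of all histogram distributions. -/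
noncomputable def histCode (n : ℕ) : PrefixCode n := (exists_histCode n).choose

/-- A mixture dominates each of its weighted components. The histogram is universally quantified
here, so it may later depend on the source. -/
theorem histCode_len_le {n : ℕ} (x : Fin n → ℕ) (l : List (ℕ × ℕ)) :
    ((histCode n).len x : ℝ) ≤
      2 - Real.logb 2 (histPrior l) + ∑ t, -Real.logb 2 (histProb l (x t)) := by
  refine ((exists_histCode n).choose_spec x).trans ?_
  have hpos : 0 < histPrior l * ∏ t, histProb l (x t) :=
    mul_pos (histPrior_pos _) (Finset.prod_pos fun t _ => histProb_pos _ _)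
  have hne : histMixture n x ≠ ⊤ :=
    ENNReal.ne_top_of_tsum_ne_top (by rw [tsum_histMixture]; simp) x
  have h1 := Real.logb_le_logb_of_le (b := 2) (by norm_num) hpos
    ((ENNReal.ofReal_le_iff_le_toReal hne).1 (ofReal_le_histMixture x l))
  rw [Real.logb_mul (histPrior_pos l).ne' (Finset.prod_pos fun t _ => histProb_pos l (x t)).ne',
    Real.logb_prod _ _ fun t _ => (histProb_pos l (x t)).ne'] at h1
  rw [Finset.sum_neg_distrib]
  linarith

/-- The expected ideal code length of one letter of the source `θ` under a histogram. -/
noncomputable def crossEntropy (θ : ℕ → ℝ) (l : List (ℕ × ℕ)) : ℝ≥0∞ :=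
  ∑' j, ENNReal.ofReal (θ j) * ENNReal.ofReal (-Real.logb 2 (histProb l j))

theorem expectedLength_histCode_le {θ : ℕ → ℝ} (hθ : θ ∈ MonotoneSources) (n : ℕ)
    (l : List (ℕ × ℕ)) :
    expectedLength θ (histCode n) ≤
      ENNReal.ofReal (2 - Real.logb 2 (histPrior l)) + n * crossEntropy θ l := by
  obtain ⟨h0, -, hs⟩ := hθ
  have hone : ∑' j, ENNReal.ofReal (θ j) = 1 := by
    rw [← ENNReal.ofReal_tsum_of_nonneg h0 hs.summable, hs.tsum_eq, ENNReal.ofReal_one]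
  have hb : ∀ x : Fin n → ℕ, ENNReal.ofReal (blockProb θ x) = ∏ t, ENNReal.ofReal (θ (x t)) :=
    fun x => ENNReal.ofReal_prod_of_nonneg fun t _ => h0 _
  have hlen : ∀ x : Fin n → ℕ, (((histCode n).len x : ℕ) : ℝ≥0∞) ≤
      ENNReal.ofReal (2 - Real.logb 2 (histPrior l)) +
        ∑ t, ENNReal.ofReal (-Real.logb 2 (histProb l (x t))) := by
    intro x
    rw [← ENNReal.ofReal_natCast, ← ENNReal.ofReal_sum_of_nonneg]
    · exact (ENNReal.ofReal_le_ofReal (histCode_len_le x l)).trans ENNReal.ofReal_add_le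
    · intro t _
      have := Real.logb_nonpos (b := 2) (by norm_num) (histProb_pos l (x t)).le
        (histProb_le_one l (x t))
      linarith
  have hmarg : ∀ t : Fin n, ∑' x : Fin n → ℕ, (∏ s, ENNReal.ofReal (θ (x s))) *
      ENNReal.ofReal (-Real.logb 2 (histProb l (x t))) = crossEntropy θ l := by
    intro t
    -- Writing the cost of letter `t` as a factor at coordinate `t` lets the sum factorize; the
    -- other coordinates each sum to one.
    have h1 : ∀ x : Fin n → ℕ, (∏ s, ENNReal.ofReal (θ (x s))) *
        ENNReal.ofReal (-Real.logb 2 (histProb l (x t))) = ∏ s, (ENNReal.ofReal (θ (x s)) *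
          if s = t then ENNReal.ofReal (-Real.logb 2 (histProb l (x s))) else 1) := by
      intro x
      rw [Finset.prod_mul_distrib, Finset.prod_ite_eq' Finset.univ t, if_pos (Finset.mem_univ t)]
    simp_rw [h1]
    rw [tsum_pi_prod (fun s a => ENNReal.ofReal (θ a) *
          if s = t then ENNReal.ofReal (-Real.logb 2 (histProb l a)) else 1),
      Finset.prod_eq_single t]
    · simp [crossEntropy]
    · intro s _ hst
      simp [hst, hone]
    · simp
  unfold expectedLength
  calc _ ≤ ∑' x : Fin n → ℕ, ((∏ t, ENNReal.ofReal (θ (x t))) *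
          ENNReal.ofReal (2 - Real.logb 2 (histPrior l)) +
        ∑ t, (∏ s, ENNReal.ofReal (θ (x s))) *
          ENNReal.ofReal (-Real.logb 2 (histProb l (x t)))) := by
        refine ENNReal.tsum_le_tsum fun x => ?_
        rw [hb, ← Finset.mul_sum, ← mul_add]
        gcongr
        exact hlen x
    _ = _ := by
        rw [ENNReal.tsum_add, ENNReal.tsum_mul_right, tsum_pi_prod (fun _ a => ENNReal.ofReal (θ a)),
          Summable.tsum_finsetSum fun _ _ => ENNReal.summable]
        simp_rw [hmarg]
        simp [hone]

theorem redundancy_histCode_le {θ : ℕ → ℝ} (hθ : θ ∈ MonotoneSources) {n : ℕ} (hn : n ≠ 0) {l : List (ℕ × ℕ)} {D r : ℝ} (hD : 0 ≤ D)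
    (hl : crossEntropy θ l ≤ entropy θ + ENNReal.ofReal D)
    (hr : D + (2 - Real.logb 2 (histPrior l)) / n ≤ r) :
    redundancy θ (histCode n) ≤ (r : EReal) := by
  have hn' : (0 : ℝ) < n := by positivity
  have h1 : expectedLength θ (histCode n) / (n : ℝ≥0∞) ≤ entropy θ + ENNReal.ofReal r := by
    refine ENNReal.div_le_of_le_mul' ((expectedLength_histCode_le hθ n l).trans ?_)
    calc _ ≤ ENNReal.ofReal (2 - Real.logb 2 (histPrior l)) +
          n * (entropy θ + ENNReal.ofReal D) := by gcongr
      _ = n * entropy θ + (ENNReal.ofReal (n * ((2 - Real.logb 2 (histPrior l)) / n)) +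
          n * ENNReal.ofReal D) := by
          rw [mul_div_cancel₀ _ hn'.ne']; ring
      _ = n * (entropy θ + (ENNReal.ofReal ((2 - Real.logb 2 (histPrior l)) / n) +
          ENNReal.ofReal D)) := by
          rw [ENNReal.ofReal_mul hn'.le, ENNReal.ofReal_natCast]; ring
      _ ≤ _ := by
          gcongr
          rw [← ENNReal.ofReal_add _ hD]
          · exact ENNReal.ofReal_le_ofReal (by linarith)
          · have := Real.logb_nonpos (b := 2) (by norm_num) (histPrior_pos l).le (histPrior_le_one l)
            apply div_nonneg _ hn'.le
            linarith
  have hr0 : 0 ≤ r := by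
    refine le_trans (add_nonneg hD (div_nonneg ?_ hn'.le)) hr
    have := Real.logb_nonpos (b := 2) (by norm_num) (histPrior_pos l).le (histPrior_le_one l)
    linarith
  unfold redundancy
  have h2 : ((expectedLength θ (histCode n) / (n : ℝ≥0∞) : ℝ≥0∞) : EReal) ≤
      (r : EReal) + (entropy θ : EReal) := by
    refine (EReal.coe_ennreal_le_coe_ennreal_iff.2 h1).trans ?_
    rw [EReal.coe_ennreal_add, EReal.coe_ennreal_ofReal, max_eq_left hr0, add_comm]
  exact EReal.sub_le_of_le_add h2

/-! ### Histograms with prescribed boundaries. -/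

/-- The list of the `g` blocks with the boundaries `b s, b (s + 1), …, b (s + g)` and the
counts `c s, …`. -/
def blockList (b c : ℕ → ℕ) : ℕ → ℕ → List (ℕ × ℕ)
  | _, 0 => []
  | s, g + 1 => (b (s + 1) - b s - 1, c s) :: blockList b c (s + 1) g

theorem histWeight_blockList_of_mem {b : ℕ → ℕ} (hb : StrictMono b) (c : ℕ → ℕ) {s g k j : ℕ}
    (hk : s ≤ k) (hk' : k < s + g) (hj : b k ≤ j) (hj' : j < b (k + 1)) :
    histWeight (blockList b c s g) (j - b s) = ((c k : ℝ) + 1) / ((b (k + 1) : ℝ) - b k) := by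
  induction g generalizing s with
  | zero => omega
  | succ g ih =>
    have h1 := hb (Nat.lt_succ_self s)
    have h2 := hb.monotone hk
    rw [Nat.succ_eq_add_one] at h1
    rw [blockList, histWeight]
    rcases hk.eq_or_lt with rfl | hlt
    · rw [if_pos (by omega), Nat.sub_sub, Nat.cast_sub (by omega)]
      push_cast
      congr 1
      ring
    · have h3 := hb.monotone (Nat.succ_le_of_lt hlt)
      rw [Nat.succ_eq_add_one] at h3
      rw [if_neg (by omega), ← ih (s := s + 1) hlt (by omega)]
      congr 1
      omega

theorem histWeight_blockList_of_le {b : ℕ → ℕ} (hb : StrictMono b) (c : ℕ → ℕ) {s g j : ℕ}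
    (hj : b (s + g) ≤ j) :
    histWeight (blockList b c s g) (j - b s) = integerProb (j - b (s + g)) := by
  induction g generalizing s with
  | zero => rfl
  | succ g ih =>
    have h1 := hb (Nat.lt_succ_self s)
    have h2 : b (s + 1) ≤ b (s + (g + 1)) := hb.monotone (by omega)
    rw [Nat.succ_eq_add_one] at h1
    have h3 : s + 1 + g = s + (g + 1) := by omega
    rw [blockList, histWeight, if_neg (by omega), ← h3, ← ih (h3 ▸ hj)]
    congr 1
    omega

theorem histTotal_blockList (b c : ℕ → ℕ) (s g : ℕ) :
    histTotal (blockList b c s g) = 1 + g + ∑ k ∈ Finset.range g, (c (s + k) : ℝ) := by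
  induction g generalizing s with
  | zero => simp [blockList, histTotal]
  | succ g ih =>
    rw [blockList, histTotal, ih, Finset.sum_range_succ']
    have h : ∀ k, s + 1 + k = s + (k + 1) := fun k => by omega
    simp_rw [h]
    push_cast
    simp only [add_zero]
    ring

/-- Each block pays one bit for continuing the list and twice the logarithm of each of its two
integers. -/
theorem neg_logb_histPrior_blockList_le {b : ℕ → ℕ} (hb : StrictMono b) (c : ℕ → ℕ) {s g : ℕ}
    {W V : ℝ} (hW : ∀ k < s + g, (b (k + 1) : ℝ) - b k + 1 ≤ W)
    (hV : ∀ k < s + g, (c k : ℝ) + 2 ≤ V) :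
    -Real.logb 2 (histPrior (blockList b c s g)) ≤
      1 + g * (1 + 2 * Real.logb 2 W + 2 * Real.logb 2 V) := by
  induction g generalizing s with
  | zero =>
    simp [blockList, histPrior, Real.logb_inv]
  | succ g ih =>
    have h1 := ih (s := s + 1) (fun k hk => hW k (by omega)) (fun k hk => hV k (by omega))
    have h2 := hb (Nat.lt_succ_self s)
    rw [Nat.succ_eq_add_one] at h2
    have h3 := hW s (by omega)
    have h4 := hV s (by omega)
    have h5 := neg_logb_integerProb_le (b (s + 1) - b s - 1)
    have h6 := neg_logb_integerProb_le (c s)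
    have h7 : Real.logb 2 (((b (s + 1) - b s - 1 : ℕ) : ℝ) + 2) ≤ Real.logb 2 W := by
      refine Real.logb_le_logb_of_le (by norm_num) (by positivity) ?_
      rw [Nat.sub_sub, Nat.cast_sub (by omega)]
      push_cast
      linarith
    have h8 : Real.logb 2 ((c s : ℝ) + 2) ≤ Real.logb 2 V :=
      Real.logb_le_logb_of_le (by norm_num) (by positivity) h4
    have p1 := (integerProb_pos (b (s + 1) - b s - 1)).ne'
    have p2 := (integerProb_pos (c s)).ne'
    rw [blockList, histPrior, Real.logb_mul (by positivity) (histPrior_pos _).ne',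
      Real.logb_mul (by norm_num) (by positivity), Real.logb_mul p1 p2, one_div, Real.logb_inv,
      Real.logb_self_eq_one (by norm_num)]
    push_cast
    linarith

/-! ### The cost of flattening a source on one block. -/

/-- Every value deviates from the mean by at most `δ` times the mean, so the variance is at most `δ
^ 2` times the squared mean. -/
theorem sum_sq_le_of_ratio {B : Finset ℕ} {f : ℕ → ℝ} (hf : ∀ j ∈ B, 0 ≤ f j) {δ : ℝ}
    (hδ : 0 ≤ δ) (hratio : ∀ i ∈ B, ∀ j ∈ B, f i ≤ (1 + δ) * f j) (hB : B.Nonempty) :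
    B.card * ∑ j ∈ B, f j ^ 2 ≤ (1 + δ ^ 2) * (∑ j ∈ B, f j) ^ 2 := by
  have hc : (0 : ℝ) < B.card := by exact_mod_cast hB.card_pos
  set P := ∑ j ∈ B, f j with hP
  have hP0 : 0 ≤ P := Finset.sum_nonneg hf
  have hdev : ∀ j ∈ B, (B.card * f j - P) ^ 2 ≤ (δ * P) ^ 2 := by
    intro j hj
    have h1 : B.card * f j ≤ (1 + δ) * P := by
      rw [hP, Finset.mul_sum, ← nsmul_eq_mul, ← Finset.sum_const]
      exact Finset.sum_le_sum fun i hi => hratio j hj i hi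
    have h2 : P ≤ (1 + δ) * (B.card * f j) := by
      calc P ≤ ∑ i ∈ B, (1 + δ) * f j := Finset.sum_le_sum fun i hi => hratio i hi j hj
        _ = _ := by rw [Finset.sum_const, nsmul_eq_mul]; ring
    apply sq_le_sq'
    · rcases le_total P (B.card * f j) with h | h
      · have : 0 ≤ δ * P := by positivity
        linarith
      · have : δ * (B.card * f j) ≤ δ * P := by gcongr
        linarith
    · linarith
  have hs := Finset.sum_le_sum hdev
  have he : ∑ j ∈ B, (B.card * f j - P) ^ 2 =
      B.card * (B.card * ∑ j ∈ B, f j ^ 2) - B.card * P ^ 2 := by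
    have : ∀ j ∈ B, ((B.card : ℝ) * f j - P) ^ 2 =
        (B.card : ℝ) ^ 2 * f j ^ 2 - 2 * B.card * P * f j + P ^ 2 := fun j _ => by ring
    rw [Finset.sum_congr rfl this, Finset.sum_add_distrib, Finset.sum_sub_distrib,
      ← Finset.mul_sum, ← Finset.mul_sum, ← hP, Finset.sum_const, nsmul_eq_mul]
    ring
  rw [he, Finset.sum_const, nsmul_eq_mul] at hs
  refine le_of_mul_le_mul_left ?_ hc
  linarith

/-- The inequality `log t ≤ t - 1` bounds the divergence by a chi-square quantity, which is a
variance and hence quadratic in `δ`. The parameter `κ` measures how far `q` may fall below the block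
average. -/
theorem sum_block_cost_le {B : Finset ℕ} {f : ℕ → ℝ} (hf : ∀ j ∈ B, 0 ≤ f j) {δ κ q : ℝ}
    (hδ : 0 ≤ δ) (hδ1 : δ ≤ 1) (hκ : 0 ≤ κ) (hq : 0 < q)
    (hratio : ∀ i ∈ B, ∀ j ∈ B, f i ≤ (1 + δ) * f j)
    (hP : ∑ j ∈ B, f j ≤ (1 + κ) * (B.card * q)) :
    ∑ j ∈ B, f j * -Real.logb 2 q ≤
      ∑ j ∈ B, (-(f j * Real.logb 2 (f j)) + (2 * κ + δ ^ 2) / Real.log 2 * f j) := by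
  have hlog : 0 < Real.log 2 := Real.log_pos (by norm_num)
  rcases B.eq_empty_or_nonempty with rfl | hB
  · simp
  have hterm : ∀ j ∈ B, f j * -Real.logb 2 q ≤
      -(f j * Real.logb 2 (f j)) + (f j ^ 2 / q - f j) / Real.log 2 := by
    intro j hj
    rcases (hf j hj).eq_or_lt with h0 | hpos
    · simp [← h0]
    · have h1 := Real.log_le_sub_one_of_pos (div_pos hpos hq)
      rw [Real.log_div hpos.ne' hq.ne'] at h1
      have h2 := div_le_div_of_nonneg_right (mul_le_mul_of_nonneg_left h1 hpos.le) hlog.le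
      simp only [Real.logb]
      have e1 : f j * (Real.log (f j) - Real.log q) / Real.log 2 =
        f j * -(Real.log q / Real.log 2) + f j * (Real.log (f j) / Real.log 2) := by ring
      have e2 : f j * (f j / q - 1) = f j ^ 2 / q - f j := by ring
      rw [e1, e2] at h2
      linarith
  refine (Finset.sum_le_sum hterm).trans ?_
  rw [Finset.sum_add_distrib, Finset.sum_add_distrib]
  refine add_le_add le_rfl ?_
  rw [← Finset.sum_div, Finset.sum_sub_distrib, ← Finset.sum_div, ← Finset.mul_sum, div_mul_eq_mul_div]
  gcongr
  have hc : (0 : ℝ) < B.card := by exact_mod_cast hB.card_pos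
  have hsq := sum_sq_le_of_ratio hf hδ hratio hB
  set P := ∑ j ∈ B, f j with hPdef
  have hP0 : 0 ≤ P := Finset.sum_nonneg hf
  have h1 : (∑ j ∈ B, f j ^ 2) / q ≤ (1 + κ) * (1 + δ ^ 2) * P := by
    rw [div_le_iff₀ hq]
    refine le_of_mul_le_mul_left (hsq.trans ?_) hc
    calc (1 + δ ^ 2) * P ^ 2 = (1 + δ ^ 2) * P * P := by ring
      _ ≤ (1 + δ ^ 2) * P * ((1 + κ) * (B.card * q)) := by gcongr
      _ = _ := by ring
  -- The cross term of `(1 + κ) * (1 + δ ^ 2)` is absorbed in a second `κ`.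
  have h2 : κ * δ ^ 2 * P ≤ κ * 1 * P := by
    gcongr
    exact pow_le_one₀ hδ hδ1
  nlinarith

theorem sum_range_le_of_blocks {b : ℕ → ℕ} (hb : Monotone b) (h0 : b 0 = 0) {F H : ℕ → ℝ} {G : ℕ}
    (h : ∀ k < G, ∑ j ∈ Finset.Ico (b k) (b (k + 1)), F j ≤
      ∑ j ∈ Finset.Ico (b k) (b (k + 1)), H j) :
    ∑ j ∈ Finset.range (b G), F j ≤ ∑ j ∈ Finset.range (b G), H j := by
  induction G with
  | zero => simp [h0]
  | succ G ih =>
    rw [← Finset.sum_range_add_sum_Ico F (hb (Nat.le_succ G)),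
      ← Finset.sum_range_add_sum_Ico H (hb (Nat.le_succ G))]
    exact add_le_add (ih fun k hk => h k (by omega)) (h G (by omega))

theorem sum_blocks {b : ℕ → ℕ} (hb : Monotone b) (h0 : b 0 = 0) (F : ℕ → ℝ) (G : ℕ) :
    ∑ k ∈ Finset.range G, ∑ j ∈ Finset.Ico (b k) (b (k + 1)), F j =
      ∑ j ∈ Finset.range (b G), F j := by
  induction G with
  | zero => simp [h0]
  | succ G ih => rw [Finset.sum_range_succ, ih, Finset.sum_range_add_sum_Ico F (hb (Nat.le_succ G))]

/-! ### Cross entropy under the rounded histogram of a source. -/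

/-- The masses of the blocks with boundaries `b`, rounded down to multiples of `1 / N`. -/
noncomputable def blockCount (θ : ℕ → ℝ) (b : ℕ → ℕ) (N : ℕ) (k : ℕ) : ℕ :=
  ⌊(N : ℝ) * ∑ j ∈ Finset.Ico (b k) (b (k + 1)), θ j⌋₊

theorem blockCount_le {θ : ℕ → ℝ} (hpos : ∀ j, 0 ≤ θ j) (b : ℕ → ℕ) (N k : ℕ) :
    (blockCount θ b N k : ℝ) ≤ N * ∑ j ∈ Finset.Ico (b k) (b (k + 1)), θ j :=
  Nat.floor_le (mul_nonneg (Nat.cast_nonneg N) (Finset.sum_nonneg fun j _ => hpos j))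

theorem sum_le_one_of_mem {θ : ℕ → ℝ} (hθ : θ ∈ MonotoneSources) (s : Finset ℕ) :
    ∑ j ∈ s, θ j ≤ 1 :=
  sum_le_hasSum s (fun i _ => hθ.1 i) hθ.2.2

theorem le_one_of_mem {θ : ℕ → ℝ} (hθ : θ ∈ MonotoneSources) (j : ℕ) : θ j ≤ 1 :=
  le_hasSum hθ.2.2 j fun i _ => hθ.1 i

theorem entropy_term_nonneg {θ : ℕ → ℝ} (hθ : θ ∈ MonotoneSources) (j : ℕ) :
    0 ≤ -(θ j * Real.logb 2 (θ j)) := by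
  have := Real.logb_nonpos (b := 2) (by norm_num) (hθ.1 j) (le_one_of_mem hθ j)
  have := mul_nonneg (hθ.1 j) (neg_nonneg.2 this)
  linarith

theorem neg_logb_histProb_nonneg (l : List (ℕ × ℕ)) (j : ℕ) :
    0 ≤ -Real.logb 2 (histProb l j) := by
  have := Real.logb_nonpos (b := 2) (by norm_num) (histProb_pos l j).le (histProb_le_one l j)
  linarith

theorem histTotal_blockCount_le {θ : ℕ → ℝ} (hθ : θ ∈ MonotoneSources) {b : ℕ → ℕ}
    (hb : StrictMono b) (h0 : b 0 = 0) (G N : ℕ) :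
    histTotal (blockList b (blockCount θ b N) 0 G) ≤ N + G + 1 := by
  have h1 : ∑ k ∈ Finset.range G, (blockCount θ b N (0 + k) : ℝ) ≤
      N * ∑ j ∈ Finset.range (b G), θ j := by
    rw [← sum_blocks hb.monotone h0 θ G, Finset.mul_sum]
    refine Finset.sum_le_sum fun k _ => ?_
    rw [zero_add]
    exact blockCount_le hθ.1 b N k
  have h2 := mul_le_mul_of_nonneg_left (sum_le_one_of_mem hθ (Finset.range (b G)))
    (Nat.cast_nonneg (α := ℝ) N)
  rw [histTotal_blockList]
  linarith

/-- The unit added to each rounded count makes it at least `N` times the true block mass, while the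
total is at most `N + G + 1`. Normalizing therefore loses at most a factor `1 + κ` with `κ = (G + 1)
/ N`. -/
theorem head_cost_le {θ : ℕ → ℝ} (hθ : θ ∈ MonotoneSources) {b : ℕ → ℕ}
    (hb : StrictMono b) (h0 : b 0 = 0) {G N : ℕ} (hN : N ≠ 0) {δ : ℝ} (hδ : 0 ≤ δ) (hδ1 : δ ≤ 1)
    (hratio : ∀ k < G, ∀ i ∈ Finset.Ico (b k) (b (k + 1)), ∀ j ∈ Finset.Ico (b k) (b (k + 1)),
      θ i ≤ (1 + δ) * θ j) :
    ∑ j ∈ Finset.range (b G),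
        θ j * -Real.logb 2 (histProb (blockList b (blockCount θ b N) 0 G) j) ≤
      ∑ j ∈ Finset.range (b G), (-(θ j * Real.logb 2 (θ j)) +
        (2 * (((G : ℝ) + 1) / N) + δ ^ 2) / Real.log 2 * θ j) := by
  have hN' : (0 : ℝ) < N := by positivity
  refine sum_range_le_of_blocks hb.monotone h0 fun k hk => ?_
  have hS0 := histTotal_pos (blockList b (blockCount θ b N) 0 G)
  have hS := histTotal_blockCount_le hθ hb h0 G N
  have hw : (0 : ℝ) < (b (k + 1) : ℝ) - b k := by
    have : (b k : ℝ) < b (k + 1) := by exact_mod_cast hb (Nat.lt_succ_self k)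
    linarith
  have hq : ∀ j ∈ Finset.Ico (b k) (b (k + 1)),
      histProb (blockList b (blockCount θ b N) 0 G) j =
        ((blockCount θ b N k : ℝ) + 1) / ((b (k + 1) : ℝ) - b k) /
          histTotal (blockList b (blockCount θ b N) 0 G) := by
    intro j hj
    rw [Finset.mem_Ico] at hj
    have := histWeight_blockList_of_mem hb (blockCount θ b N) (Nat.zero_le k)
      (by omega : k < 0 + G) hj.1 hj.2
    rw [h0, Nat.sub_zero] at this
    rw [histProb, this]
  generalize histTotal (blockList b (blockCount θ b N) 0 G) = S at *
  rw [Finset.sum_congr rfl fun j hj => by rw [hq j hj]]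
  have hc1 : (N : ℝ) * ∑ j ∈ Finset.Ico (b k) (b (k + 1)), θ j ≤ (blockCount θ b N k : ℝ) + 1 :=
    (Nat.lt_floor_add_one _).le
  have hc0 : 0 < (blockCount θ b N k : ℝ) + 1 := by positivity
  generalize (blockCount θ b N k : ℝ) + 1 = c at *
  have hP0 : 0 ≤ ∑ j ∈ Finset.Ico (b k) (b (k + 1)), θ j := Finset.sum_nonneg fun j _ => hθ.1 j
  have hκ : (1 + ((G : ℝ) + 1) / N) * N = N + G + 1 := by
    field_simp; ring
  have hκ0 : 0 ≤ ((G : ℝ) + 1) / N := by positivity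
  generalize ((G : ℝ) + 1) / N = κ at *
  refine sum_block_cost_le (fun j _ => hθ.1 j) hδ hδ1 hκ0 (by positivity) (hratio k hk) ?_
  rw [Nat.card_Ico, Nat.cast_sub (hb.monotone (Nat.le_succ k))]
  have h2 : (1 + κ) * (((b (k + 1) : ℝ) - b k) * (c / ((b (k + 1) : ℝ) - b k) / S)) =
      (1 + κ) * c / S := by
    field_simp
  rw [Nat.succ_eq_add_one, h2, le_div_iff₀ hS0]
  refine (mul_le_mul_of_nonneg_left hS hP0).trans ?_
  rw [← hκ]
  have := mul_le_mul_of_nonneg_left hc1 (by linarith : 0 ≤ 1 + κ)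
  linarith

theorem tail_cost_le {θ : ℕ → ℝ} (hθ : θ ∈ MonotoneSources) {b : ℕ → ℕ}
    (hb : StrictMono b) (h0 : b 0 = 0) (G N j : ℕ) :
    -Real.logb 2 (histProb (blockList b (blockCount θ b N) 0 G) (j + b G)) ≤
      Real.logb 2 ((N : ℝ) + G + 1) + 2 * Real.logb 2 (((j + b G : ℕ) : ℝ) + 2) := by
  have hS0 := histTotal_pos (blockList b (blockCount θ b N) 0 G)
  have hS := histTotal_blockCount_le hθ hb h0 G N
  have h1 := histWeight_blockList_of_le hb (blockCount θ b N) (s := 0) (g := G) (j := j + b G)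
    (by simp)
  rw [h0, Nat.sub_zero, zero_add, Nat.add_sub_cancel] at h1
  rw [histProb, h1, Real.logb_div (integerProb_pos j).ne' hS0.ne']
  have h2 := neg_logb_integerProb_le j
  have h3 : Real.logb 2 ((j : ℝ) + 2) ≤ Real.logb 2 (((j + b G : ℕ) : ℝ) + 2) := by
    refine Real.logb_le_logb_of_le (by norm_num) (by positivity) ?_
    push_cast
    have : (0 : ℝ) ≤ b G := by positivity
    linarith
  have h4 := Real.logb_le_logb_of_le (b := 2) (by norm_num) hS0 hS
  linarith

theorem sum_head_cost_le {θ : ℕ → ℝ} (hθ : θ ∈ MonotoneSources) (l : List (ℕ × ℕ)) {m : ℕ}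
    {D : ℝ} (hD : 0 ≤ D)
    (h : ∑ j ∈ Finset.range m, θ j * -Real.logb 2 (histProb l j) ≤
      ∑ j ∈ Finset.range m, (-(θ j * Real.logb 2 (θ j)) + D * θ j)) :
    ∑ j ∈ Finset.range m, ENNReal.ofReal (θ j) * ENNReal.ofReal (-Real.logb 2 (histProb l j)) ≤
      entropy θ + ENNReal.ofReal D := by
  simp_rw [← ENNReal.ofReal_mul (hθ.1 _)]
  rw [← ENNReal.ofReal_sum_of_nonneg fun j _ =>
    mul_nonneg (hθ.1 j) (neg_logb_histProb_nonneg l j)]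
  have h1 : ∑ j ∈ Finset.range m, θ j * -Real.logb 2 (histProb l j) ≤
      ∑ j ∈ Finset.range m, -(θ j * Real.logb 2 (θ j)) + D := by
    refine h.trans ?_
    rw [Finset.sum_add_distrib, ← Finset.mul_sum]
    exact add_le_add le_rfl (mul_le_of_le_one_right hD (sum_le_one_of_mem hθ _))
  refine (ENNReal.ofReal_le_ofReal h1).trans (ENNReal.ofReal_add_le.trans ?_)
  refine add_le_add ?_ le_rfl
  rw [ENNReal.ofReal_sum_of_nonneg fun j _ => entropy_term_nonneg hθ j]
  exact ENNReal.sum_le_tsum _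

theorem crossEntropy_blockList_le {θ : ℕ → ℝ} (hθ : θ ∈ MonotoneSources) {b : ℕ → ℕ}
    (hb : StrictMono b) (h0 : b 0 = 0) {G N : ℕ} (hN : N ≠ 0) {δ : ℝ} (hδ : 0 ≤ δ) (hδ1 : δ ≤ 1)
    (hratio : ∀ k < G, ∀ i ∈ Finset.Ico (b k) (b (k + 1)), ∀ j ∈ Finset.Ico (b k) (b (k + 1)),
      θ i ≤ (1 + δ) * θ j) :
    crossEntropy θ (blockList b (blockCount θ b N) 0 G) ≤ entropy θ +
      ENNReal.ofReal ((2 * (((G : ℝ) + 1) / N) + δ ^ 2) / Real.log 2) +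
      ∑' j : ℕ, ENNReal.ofReal (θ (j + b G) *
        (Real.logb 2 ((N : ℝ) + G + 1) + 2 * Real.logb 2 (((j + b G : ℕ) : ℝ) + 2))) := by
  have hD : 0 ≤ (2 * (((G : ℝ) + 1) / N) + δ ^ 2) / Real.log 2 := by
    have : 0 < Real.log 2 := Real.log_pos (by norm_num)
    positivity
  unfold crossEntropy
  rw [← Summable.sum_add_tsum_nat_add' (k := b G) ENNReal.summable]
  refine add_le_add (sum_head_cost_le hθ _ hD (head_cost_le hθ hb h0 hN hδ hδ1 hratio))
    (ENNReal.tsum_le_tsum fun j => ?_)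
  rw [← ENNReal.ofReal_mul (hθ.1 _)]
  exact ENNReal.ofReal_le_ofReal (mul_le_mul_of_nonneg_left (tail_cost_le hθ hb h0 G N j) (hθ.1 _))

theorem one_le_logb_add_two (j : ℕ) : 1 ≤ Real.logb 2 ((j : ℝ) + 2) := by
  rw [Real.le_logb_iff_rpow_le (by norm_num) (by positivity), Real.rpow_one]
  have : (0 : ℝ) ≤ j := by positivity
  linarith

/-- The constant `C` absorbs the normalization cost `log (N + G + 1)` of tail letters. Universality
needs a `C` independent of the cutoff, obtained from `b G ≤ j`; the rate estimate only uses `log (j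
+ 2) ≥ 1`. -/
theorem crossEntropy_le_of_summable {θ : ℕ → ℝ} (hθ : θ ∈ MonotoneSources) {b : ℕ → ℕ}
    (hb : StrictMono b) (h0 : b 0 = 0) {G N : ℕ} (hN : N ≠ 0) {δ : ℝ} (hδ : 0 ≤ δ) (hδ1 : δ ≤ 1)
    (hratio : ∀ k < G, ∀ i ∈ Finset.Ico (b k) (b (k + 1)), ∀ j ∈ Finset.Ico (b k) (b (k + 1)),
      θ i ≤ (1 + δ) * θ j)
    (hs : Summable fun j : ℕ => θ j * Real.logb 2 ((j : ℝ) + 2)) {C : ℝ} (hC : 0 ≤ C)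
    (htail : ∀ j : ℕ, b G ≤ j → Real.logb 2 ((N : ℝ) + G + 1) + 2 * Real.logb 2 ((j : ℝ) + 2) ≤
      C * Real.logb 2 ((j : ℝ) + 2)) :
    crossEntropy θ (blockList b (blockCount θ b N) 0 G) ≤ entropy θ +
      ENNReal.ofReal ((2 * (((G : ℝ) + 1) / N) + δ ^ 2) / Real.log 2 +
        C * ∑' j : ℕ, θ (j + b G) * Real.logb 2 (((j + b G : ℕ) : ℝ) + 2)) := by
  have hnn : ∀ j : ℕ, 0 ≤ θ j * Real.logb 2 ((j : ℝ) + 2) := fun j =>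
    mul_nonneg (hθ.1 j) (zero_le_one.trans (one_le_logb_add_two j))
  have hs' : Summable fun j : ℕ => θ (j + b G) * Real.logb 2 (((j + b G : ℕ) : ℝ) + 2) :=
    (summable_nat_add_iff (f := fun j : ℕ => θ j * Real.logb 2 ((j : ℝ) + 2)) (b G)).2 hs
  refine (crossEntropy_blockList_le hθ hb h0 hN hδ hδ1 hratio).trans ?_
  have hlog : 0 < Real.log 2 := Real.log_pos (by norm_num)
  rw [ENNReal.ofReal_add (by positivity) (mul_nonneg hC (tsum_nonneg fun j => hnn _)), add_assoc]
  refine add_le_add le_rfl (add_le_add le_rfl ?_)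
  rw [← tsum_mul_left, ENNReal.ofReal_tsum_of_nonneg (fun j => mul_nonneg hC (hnn _))
    (hs'.mul_left C)]
  refine ENNReal.tsum_le_tsum fun j => ENNReal.ofReal_le_ofReal ?_
  rw [mul_left_comm]
  exact mul_le_mul_of_nonneg_left (htail _ (Nat.le_add_left _ _)) (hθ.1 _)

/-! ### Universality. -/

theorem summable_entropy_terms {θ : ℕ → ℝ} (hθ : θ ∈ MonotoneSources) (hH : entropy θ ≠ ⊤) :
    Summable fun j : ℕ => -(θ j * Real.logb 2 (θ j)) := by
  have := ENNReal.summable_toReal hH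
  refine this.congr fun j => ?_
  rw [ENNReal.toReal_ofReal (entropy_term_nonneg hθ j)]

theorem mul_succ_le_one {θ : ℕ → ℝ} (hθ : θ ∈ MonotoneSources) (j : ℕ) :
    θ j * ((j : ℝ) + 1) ≤ 1 := by
  refine le_trans ?_ (sum_le_one_of_mem hθ (Finset.range (j + 1)))
  calc θ j * ((j : ℝ) + 1) = ∑ i ∈ Finset.range (j + 1), θ j := by
        rw [Finset.sum_const, Finset.card_range, nsmul_eq_mul]; push_cast; ring
    _ ≤ _ := Finset.sum_le_sum fun i hi =>
        hθ.2.1 (Nat.lt_succ_iff.1 (Finset.mem_range.1 hi))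

/-- By `mul_succ_le_one`, `log (j + 1) ≤ -log (θ j)` wherever `θ j > 0`, so the entropy series
dominates. -/
theorem summable_mul_logb {θ : ℕ → ℝ} (hθ : θ ∈ MonotoneSources) (hH : entropy θ ≠ ⊤) :
    Summable fun j : ℕ => θ j * Real.logb 2 ((j : ℝ) + 2) := by
  refine Summable.of_nonneg_of_le (fun j => mul_nonneg (hθ.1 j)
    (zero_le_one.trans (one_le_logb_add_two j))) (fun j => ?_)
    (hθ.2.2.summable.add (summable_entropy_terms hθ hH))
  rcases (hθ.1 j).eq_or_lt with h | h
  · simp [← h]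
  · have h1 : Real.logb 2 ((j : ℝ) + 2) ≤ 1 + Real.logb 2 ((j : ℝ) + 1) := by
      have h2 := Real.logb_mul (b := 2) (x := 2) (y := (j : ℝ) + 1) (by norm_num) (by positivity)
      rw [Real.logb_self_eq_one (by norm_num)] at h2
      rw [← h2]
      refine Real.logb_le_logb_of_le (by norm_num) (by positivity) ?_
      have : (0 : ℝ) ≤ j := by positivity
      linarith
    have h2 : Real.logb 2 (θ j) + Real.logb 2 ((j : ℝ) + 1) ≤ 0 := by
      rw [← Real.logb_mul h.ne' (by positivity)]
      exact Real.logb_nonpos (by norm_num) (by positivity) (mul_succ_le_one hθ j)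
    have h3 : θ j * Real.logb 2 ((j : ℝ) + 2) ≤ θ j * (1 - Real.logb 2 (θ j)) :=
      mul_le_mul_of_nonneg_left (by linarith) h.le
    linarith

theorem exists_crossEntropy_le {θ : ℕ → ℝ} (hθ : θ ∈ MonotoneSources) (hH : entropy θ ≠ ⊤) {δ : ℝ}
    (hδ : 0 < δ) : ∃ l, crossEntropy θ l ≤ entropy θ + ENNReal.ofReal δ := by
  have hlog : 0 < Real.log 2 := Real.log_pos (by norm_num)
  have hs := summable_mul_logb hθ hH
  -- With `N = (m + 1) * K` the rounding loss is `κ = 1 / K`, and `log (N + m + 1)` splits as `log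
  -- (m + 1) + log (K + 1)`. Hence `C` depends on `K` alone, and `m` can be chosen after it.
  obtain ⟨K, hK⟩ := exists_nat_gt (4 / (δ * Real.log 2))
  have hK0 : (0 : ℝ) < K := lt_trans (by positivity) hK
  have hKne : K ≠ 0 := by
    rintro rfl; simp at hK0
  have hlogK : 0 ≤ Real.logb 2 ((K : ℝ) + 1) := Real.logb_nonneg (by norm_num) (by linarith)
  set C : ℝ := 3 + Real.logb 2 ((K : ℝ) + 1) with hCdef
  have hC : 0 < C := by linarith
  have htend := tendsto_sum_nat_add fun j : ℕ => θ j * Real.logb 2 ((j : ℝ) + 2)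
  obtain ⟨m, hm⟩ := (htend.eventually (gt_mem_nhds (show 0 < δ / (2 * C) by positivity))).exists
  refine ⟨_, (crossEntropy_le_of_summable hθ (b := id) strictMono_id rfl (G := m)
    (N := (m + 1) * K) (by positivity) le_rfl zero_le_one ?_ hs hC.le ?_).trans ?_⟩
  · intro k _ i hi j hj
    simp only [id, Finset.mem_Ico] at hi hj
    have : i = j := by omega
    subst this
    simp
  · intro j hj
    simp only [id] at hj
    have e : (((m + 1) * K : ℕ) : ℝ) + m + 1 = ((m : ℝ) + 1) * ((K : ℝ) + 1) := by
      push_cast; ring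
    rw [e, Real.logb_mul (by positivity) (by positivity)]
    have h1 : Real.logb 2 ((m : ℝ) + 1) ≤ Real.logb 2 ((j : ℝ) + 2) := by
      refine Real.logb_le_logb_of_le (by norm_num) (by positivity) ?_
      have : (m : ℝ) ≤ j := by exact_mod_cast hj
      linarith
    have h2 := mul_le_mul_of_nonneg_left (one_le_logb_add_two j) hlogK
    rw [hCdef]
    linarith
  · refine add_le_add le_rfl (ENNReal.ofReal_le_ofReal ?_)
    have h1 : C * ∑' j : ℕ, θ (j + id m) * Real.logb 2 (((j + id m : ℕ) : ℝ) + 2) ≤ δ / 2 := by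
      have := mul_le_mul_of_nonneg_left hm.le hC.le
      refine this.trans (le_of_eq ?_)
      field_simp
    have h2 : (2 * (((m : ℝ) + 1) / (((m + 1) * K : ℕ) : ℝ)) + 0 ^ 2) / Real.log 2 ≤ δ / 2 := by
      rw [div_lt_iff₀ (by positivity)] at hK
      push_cast
      rw [div_mul_cancel_left₀ (by positivity), div_le_iff₀ hlog, zero_pow two_ne_zero, add_zero,
        ← div_eq_mul_inv, div_le_iff₀ hK0]
      linarith
    linarith

theorem isUniversal_histCode : IsUniversal histCode := by
  intro θ hθ hH δ hδ
  obtain ⟨l, hl⟩ := exists_crossEntropy_le hθ hH (half_pos hδ)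
  have ht := tendsto_const_div_atTop_nhds_zero_nat (2 - Real.logb 2 (histPrior l))
  filter_upwards [ht.eventually (gt_mem_nhds (half_pos hδ)), eventually_ne_atTop 0] with n hn hn0
  exact redundancy_histCode_le hθ hn0 (half_pos hδ).le hl (by linarith)

/-! ### The slow source: tails, entropy and local ratios. -/

/-- The convex function `t ^ (-γ)` lies above its tangent at `y`. -/
theorem rpow_neg_sub_rpow_neg_ge {x y γ : ℝ} (hx : 0 < x) (hy : 0 < y) (hγ : 0 ≤ γ) :
    γ * (y - x) / y ^ (1 + γ) ≤ x ^ (-γ) - y ^ (-γ) := by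
  have h1 : 1 - γ * (x / y - 1) ≤ (x / y) ^ (-γ) := by
    rw [Real.rpow_def_of_pos (div_pos hx hy)]
    have h2 := Real.add_one_le_exp (Real.log (x / y) * -γ)
    have h3 := mul_le_mul_of_nonneg_left (Real.log_le_sub_one_of_pos (div_pos hx hy)) hγ
    linarith
  rw [Real.div_rpow hx.le hy.le, le_div_iff₀ (by positivity)] at h1
  have h4 : γ * (y - x) / y ^ (1 + γ) = γ * (1 - x / y) * y ^ (-γ) := by
    rw [Real.rpow_add hy, Real.rpow_one, Real.rpow_neg hy.le]
    have : 0 < y ^ γ := by positivity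
    field_simp
  rw [h4]
  linarith

/-- Put `r = v / u`. Since `2 * log 2 > 1` for the natural logarithm, `log r ≤ r ^ 2 - 1` holds in
base two, and the base-two logarithm of `u` is at least one. -/
theorem logb_le_sq_ratio_mul_logb {u v : ℝ} (hu : 2 ≤ u) (huv : u ≤ v) :
    Real.logb 2 v ≤ (v / u) ^ 2 * Real.logb 2 u := by
  have hu0 : 0 < u := by linarith
  have hr : 1 ≤ v / u := (one_le_div hu0).2 huv
  have h1 : 1 ≤ Real.logb 2 u := by
    rwa [Real.le_logb_iff_rpow_le (by norm_num) hu0, Real.rpow_one]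
  have h2 : Real.logb 2 (v / u) ≤ (v / u) ^ 2 - 1 := by
    have h3 := Real.log_le_sub_one_of_pos (show 0 < (v / u) ^ 2 by positivity)
    rw [Real.log_pow] at h3
    push_cast at h3
    have h4 := Real.log_two_gt_d9
    rw [Real.logb, div_le_iff₀ (by linarith)]
    have h5 : 0 ≤ (v / u) ^ 2 - 1 := by nlinarith
    nlinarith
  have h3 : Real.logb 2 v = Real.logb 2 u + Real.logb 2 (v / u) := by
    rw [← Real.logb_mul (by positivity) (by positivity), mul_div_cancel₀ _ hu0.ne']
  have h4 : 0 ≤ ((v / u) ^ 2 - 1) * (Real.logb 2 u - 1) :=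
    mul_nonneg (by nlinarith) (by linarith)
  rw [h3]
  linarith

section SlowSource

variable {γ a : ℝ} {θ : ℕ → ℝ}

theorem slow_const_pos (hθ : θ ∈ MonotoneSources)
    (h : ∀ j : ℕ, θ j = a / (((j : ℝ) + 2) * (Real.logb 2 ((j : ℝ) + 2)) ^ (2 + γ))) : 0 < a := by
  have h0 : θ 0 = a / 2 := by rw [h 0]; simp
  rcases (hθ.1 0).eq_or_lt with h1 | h1
  · have ha : a = 0 := by linarith
    have : θ = fun _ => 0 := by funext j; rw [h j, ha, zero_div]
    have h2 := hθ.2.2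
    rw [this] at h2
    exact absurd (h2.unique hasSum_zero) one_ne_zero
  · linarith

theorem slow_const_le (hθ : θ ∈ MonotoneSources)
    (h : ∀ j : ℕ, θ j = a / (((j : ℝ) + 2) * (Real.logb 2 ((j : ℝ) + 2)) ^ (2 + γ))) : a ≤ 2 := by
  have h0 : θ 0 = a / 2 := by rw [h 0]; simp
  have := le_one_of_mem hθ 0
  linarith

/-- A telescoping form of the integral test for `1 / (x (log x) ^ (1 + γ))`, using `log (j + 2) -
log (j + 1) ≥ 1 / (j + 2)`. The letter `j = 0` is excluded because `log 1 = 0`. -/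
theorem slow_term_le (hγ : 0 < γ) (ha : 0 < a)
    (h : ∀ j : ℕ, θ j = a / (((j : ℝ) + 2) * (Real.logb 2 ((j : ℝ) + 2)) ^ (2 + γ)))
    {j : ℕ} (hj : j ≠ 0) :
    θ j * Real.logb 2 ((j : ℝ) + 2) ≤ a / γ * ((Real.logb 2 ((j : ℝ) + 1)) ^ (-γ) -
      (Real.logb 2 (((j + 1 : ℕ) : ℝ) + 1)) ^ (-γ)) := by
  have hj1 : (1 : ℝ) ≤ j := by exact_mod_cast Nat.one_le_iff_ne_zero.2 hj
  have e : ((j + 1 : ℕ) : ℝ) + 1 = j + 2 := by push_cast; ring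
  have hL := one_le_logb_add_two j
  have hx : 0 < Real.logb 2 ((j : ℝ) + 1) := Real.logb_pos (by norm_num) (by linarith)
  have h1 := rpow_neg_sub_rpow_neg_ge hx (zero_lt_one.trans_le hL) hγ.le
  have h2 : 1 / ((j : ℝ) + 2) ≤ Real.logb 2 ((j : ℝ) + 2) - Real.logb 2 ((j : ℝ) + 1) := by
    rw [← Real.logb_div (by positivity) (by positivity), Real.logb, le_div_iff₀
      (Real.log_pos (by norm_num))]
    have h3 := Real.log_le_sub_one_of_pos (show 0 < ((j : ℝ) + 1) / (j + 2) by positivity)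
    have h4 : Real.log (((j : ℝ) + 2) / (j + 1)) = -Real.log (((j : ℝ) + 1) / (j + 2)) := by
      rw [← Real.log_inv, inv_div]
    have h5 : ((j : ℝ) + 1) / (j + 2) - 1 = -(1 / ((j : ℝ) + 2)) := by field_simp; ring
    have h6 := Real.log_two_lt_d9
    have h7 : 1 / ((j : ℝ) + 2) * Real.log 2 ≤ 1 / ((j : ℝ) + 2) * 1 := by
      gcongr; linarith
    rw [h4]
    linarith
  rw [e]
  set L := Real.logb 2 ((j : ℝ) + 2) with hLdef
  have hL0 : 0 < L := by linarith
  calc θ j * L = a / γ * (γ * (1 / ((j : ℝ) + 2)) / L ^ (1 + γ)) := by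
        have e2 : (2 : ℝ) + γ = 1 + (1 + γ) := by ring
        rw [h j, ← hLdef, e2, Real.rpow_add hL0 1, Real.rpow_one]
        have : 0 < L ^ (1 + γ) := by positivity
        field_simp
    _ ≤ a / γ * (γ * (L - Real.logb 2 ((j : ℝ) + 1)) / L ^ (1 + γ)) := by gcongr
    _ ≤ _ := by gcongr

theorem slow_sum_range_le (hγ : 0 < γ) (ha : 0 < a)
    (h : ∀ j : ℕ, θ j = a / (((j : ℝ) + 2) * (Real.logb 2 ((j : ℝ) + 2)) ^ (2 + γ)))
    {m : ℕ} (hm : m ≠ 0) (n : ℕ) :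
    ∑ j ∈ Finset.range n, θ (j + m) * Real.logb 2 (((j + m : ℕ) : ℝ) + 2) ≤
      a / γ * (Real.logb 2 ((m : ℝ) + 1)) ^ (-γ) := by
  have hstep : ∑ j ∈ Finset.range n, θ (j + m) * Real.logb 2 (((j + m : ℕ) : ℝ) + 2) ≤
      a / γ * ((Real.logb 2 ((m : ℝ) + 1)) ^ (-γ) -
        (Real.logb 2 (((n + m : ℕ) : ℝ) + 1)) ^ (-γ)) := by
    induction n with
    | zero => simp
    | succ n ih =>
      rw [Finset.sum_range_succ]
      have := slow_term_le hγ ha h (j := n + m) (by omega)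
      have e : n + 1 + m = n + m + 1 := by omega
      rw [e]
      linarith
  refine hstep.trans ?_
  gcongr
  have : 0 ≤ (Real.logb 2 (((n + m : ℕ) : ℝ) + 1)) ^ (-γ) :=
    Real.rpow_nonneg (Real.logb_nonneg (by norm_num) (by
      have : (0 : ℝ) ≤ ((n + m : ℕ) : ℝ) := by positivity
      linarith)) _
  linarith

theorem slow_mul_logb_nonneg (hθ : θ ∈ MonotoneSources) (j : ℕ) :
    0 ≤ θ j * Real.logb 2 ((j : ℝ) + 2) :=
  mul_nonneg (hθ.1 j) (zero_le_one.trans (one_le_logb_add_two j))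

theorem slow_summable (hγ : 0 < γ) (hθ : θ ∈ MonotoneSources)
    (h : ∀ j : ℕ, θ j = a / (((j : ℝ) + 2) * (Real.logb 2 ((j : ℝ) + 2)) ^ (2 + γ))) :
    Summable fun j : ℕ => θ j * Real.logb 2 ((j : ℝ) + 2) := by
  rw [← summable_nat_add_iff 1]
  exact summable_of_sum_range_le (fun j => slow_mul_logb_nonneg hθ (j + 1))
    (slow_sum_range_le hγ (slow_const_pos hθ h) h one_ne_zero)

/-- The bound `a ≤ 2`, read off the first letter, removes the normalizing factor from the constant.
-/
theorem slow_tail_le (hγ : 0 < γ) (hθ : θ ∈ MonotoneSources)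
    (h : ∀ j : ℕ, θ j = a / (((j : ℝ) + 2) * (Real.logb 2 ((j : ℝ) + 2)) ^ (2 + γ)))
    {m : ℕ} (hm : m ≠ 0) :
    ∑' j : ℕ, θ (j + m) * Real.logb 2 (((j + m : ℕ) : ℝ) + 2) ≤
      2 / γ * (Real.logb 2 ((m : ℝ) + 1)) ^ (-γ) := by
  refine (Real.tsum_le_of_sum_range_le (fun j => slow_mul_logb_nonneg hθ (j + m))
    (slow_sum_range_le hγ (slow_const_pos hθ h) h hm)).trans ?_
  have : 0 ≤ (Real.logb 2 ((m : ℝ) + 1)) ^ (-γ) :=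
    Real.rpow_nonneg (Real.logb_nonneg (by norm_num) (by
      have : (0 : ℝ) ≤ (m : ℝ) := by positivity
      linarith)) _
  gcongr
  exact slow_const_le hθ h

theorem slow_entropy_ne_top (hγ : 0 < γ) (hθ : θ ∈ MonotoneSources)
    (h : ∀ j : ℕ, θ j = a / (((j : ℝ) + 2) * (Real.logb 2 ((j : ℝ) + 2)) ^ (2 + γ))) :
    entropy θ ≠ ⊤ := by
  have ha := slow_const_pos hθ h
  have hs := slow_summable hγ hθ h
  have hb : ∀ j : ℕ, -(θ j * Real.logb 2 (θ j)) ≤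
      (|Real.logb 2 a| + 1 + (2 + γ)) * (θ j * Real.logb 2 ((j : ℝ) + 2)) := by
    intro j
    have hL := one_le_logb_add_two j
    have h2 : -Real.logb 2 (θ j) = -Real.logb 2 a + Real.logb 2 ((j : ℝ) + 2) +
        (2 + γ) * Real.logb 2 (Real.logb 2 ((j : ℝ) + 2)) := by
      have hp : 0 < Real.logb 2 ((j : ℝ) + 2) := by linarith
      rw [h j, Real.logb_div ha.ne' (by positivity), Real.logb_mul (by positivity) (by positivity),
        Real.logb_rpow_eq_mul_logb_of_pos hp]
      ring
    set L := Real.logb 2 ((j : ℝ) + 2)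
    have h3 : Real.logb 2 L ≤ L := by
      rw [Real.logb_le_iff_le_rpow (by norm_num) (by linarith)]
      have h4 := one_add_mul_self_le_rpow_one_add (s := 1) (by norm_num) hL
      norm_num at h4
      linarith
    have h5 : -Real.logb 2 a ≤ |Real.logb 2 a| * L :=
      (neg_le_abs _).trans (le_mul_of_one_le_right (abs_nonneg _) hL)
    have h6 : (2 + γ) * Real.logb 2 L ≤ (2 + γ) * L := by gcongr
    have h7 : -Real.logb 2 (θ j) ≤ (|Real.logb 2 a| + 1 + (2 + γ)) * L := by linarith
    have h8 := mul_le_mul_of_nonneg_left h7 (hθ.1 j)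
    linarith
  have := Summable.of_nonneg_of_le (entropy_term_nonneg hθ) hb (hs.mul_left _)
  unfold entropy
  rw [← ENNReal.ofReal_tsum_of_nonneg (entropy_term_nonneg hθ) this]
  exact ENNReal.ofReal_ne_top

/-- For `r = (j + 2) / (i + 2) ≥ 1` the linear factor contributes `r` and the logarithm at most `(r
^ 2) ^ (2 + γ)`, hence the exponent `5 + 2 * γ`. Bernoulli's inequality then gives `2 ^ t ≤ 1 + t`
for `0 ≤ t ≤ 1`. -/
theorem slow_ratio (hγ : 0 < γ) (hθ : θ ∈ MonotoneSources)
    (h : ∀ j : ℕ, θ j = a / (((j : ℝ) + 2) * (Real.logb 2 ((j : ℝ) + 2)) ^ (2 + γ)))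
    {η : ℝ} (hη : 0 ≤ η) (hη1 : (5 + 2 * γ) * η ≤ 1) {i j : ℕ}
    (hij : (j : ℝ) + 2 ≤ 2 ^ η * ((i : ℝ) + 2)) :
    θ i ≤ (1 + (5 + 2 * γ) * η) * θ j := by
  have hδ : 0 ≤ (5 + 2 * γ) * η := by positivity
  rcases le_total j i with hji | hji
  · exact (hθ.2.1 hji).trans (le_mul_of_one_le_left (hθ.1 j) (by linarith))
  have ha := slow_const_pos hθ h
  have hiR : (0 : ℝ) ≤ i := by positivity
  have hijR : (i : ℝ) ≤ j := by exact_mod_cast hji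
  have hLi := one_le_logb_add_two i
  have hLj := one_le_logb_add_two j
  have h1 := logb_le_sq_ratio_mul_logb (u := (i : ℝ) + 2) (v := (j : ℝ) + 2) (by linarith) (by linarith)
  rw [h i, h j]
  set u := (i : ℝ) + 2
  set v := (j : ℝ) + 2
  have hu : 0 < u := by positivity
  have hv : 0 < v := by positivity
  set r := v / u with hr
  have hr1 : 1 ≤ r := (one_le_div hu).2 (by linarith)
  have hr0 : 0 < r := by linarith
  have hr2 : r ≤ 2 ^ η := by rw [hr, div_le_iff₀ hu]; exact hij
  have hvr : v = r * u := by rw [hr]; field_simp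
  set x := Real.logb 2 u
  set y := Real.logb 2 v
  have hx : 0 < x := by linarith
  have hy : 0 < y := by linarith
  have h2 : y ^ (2 + γ) ≤ r ^ (4 + 2 * γ) * x ^ (2 + γ) := by
    calc y ^ (2 + γ) ≤ (r ^ 2 * x) ^ (2 + γ) := Real.rpow_le_rpow hy.le h1 (by linarith)
      _ = _ := by
        rw [Real.mul_rpow (by positivity) hx.le, ← Real.rpow_natCast, ← Real.rpow_mul hr0.le]
        congr 2
        push_cast
        ring
  have h3 : r ^ (5 + 2 * γ) ≤ 1 + (5 + 2 * γ) * η := by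
    calc r ^ (5 + 2 * γ) ≤ ((2 : ℝ) ^ η) ^ (5 + 2 * γ) :=
          Real.rpow_le_rpow hr0.le hr2 (by linarith)
      _ = (1 + 1) ^ ((5 + 2 * γ) * η) := by
          rw [← Real.rpow_mul (by norm_num)]
          congr 1
          · norm_num
          · ring
      _ ≤ 1 + ((5 + 2 * γ) * η) * 1 := rpow_one_add_le_one_add_mul_self (by norm_num) hδ hη1
      _ = _ := by ring
  have h4 : v * y ^ (2 + γ) ≤ (1 + (5 + 2 * γ) * η) * (u * x ^ (2 + γ)) := by
    calc v * y ^ (2 + γ) ≤ (r * u) * (r ^ (4 + 2 * γ) * x ^ (2 + γ)) := by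
          rw [hvr]; gcongr
      _ = r ^ (5 + 2 * γ) * (u * x ^ (2 + γ)) := by
          have e : 5 + 2 * γ = 1 + (4 + 2 * γ) := by ring
          rw [e, Real.rpow_add hr0 1, Real.rpow_one]; ring
      _ ≤ _ := by gcongr
  rw [mul_div_assoc', div_le_div_iff₀ (by positivity) (by positivity)]
  have := mul_le_mul_of_nonneg_left h4 ha.le
  linarith

end SlowSource

/-! ### Geometric blocks and the choice of parameters. -/

/-- Boundaries `2 = e₀ < e₁ < …` growing by the factor `2 ^ η`, up to rounding. -/
noncomputable def geomBoundary (η : ℝ) : ℕ → ℕ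
  | 0 => 2
  | k + 1 => ⌊(2 : ℝ) ^ η * geomBoundary η k⌋₊ + 1

theorem geomBoundary_le_mul {η : ℝ} (k : ℕ) :
    (geomBoundary η (k + 1) : ℝ) ≤ 2 ^ η * geomBoundary η k + 1 := by
  rw [geomBoundary]
  push_cast
  have := Nat.floor_le (show 0 ≤ (2 : ℝ) ^ η * geomBoundary η k by positivity)
  linarith

theorem mul_lt_geomBoundary {η : ℝ} (k : ℕ) :
    (2 : ℝ) ^ η * geomBoundary η k < geomBoundary η (k + 1) := by
  conv_rhs => rw [geomBoundary]
  push_cast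
  exact Nat.lt_floor_add_one _

theorem geomBoundary_strictMono {η : ℝ} (hη : 0 ≤ η) : StrictMono (geomBoundary η) := by
  refine strictMono_nat_of_lt_succ fun k => ?_
  have h1 := mul_lt_geomBoundary (η := η) k
  have h2 : (1 : ℝ) ≤ 2 ^ η := Real.one_le_rpow (by norm_num) hη
  have h3 : (geomBoundary η k : ℝ) ≤ 2 ^ η * geomBoundary η k :=
    le_mul_of_one_le_left (by positivity) h2
  exact_mod_cast h3.trans_lt h1

theorem two_le_geomBoundary {η : ℝ} (hη : 0 ≤ η) (k : ℕ) : 2 ≤ geomBoundary η k :=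
  (geomBoundary_strictMono hη).monotone (Nat.zero_le k)

theorem le_geomBoundary {η : ℝ} (k : ℕ) :
    2 * (2 : ℝ) ^ (η * k) ≤ geomBoundary η k := by
  induction k with
  | zero => simp [geomBoundary]
  | succ k ih =>
    refine le_trans ?_ (mul_lt_geomBoundary k).le
    have e : η * ((k + 1 : ℕ) : ℝ) = η + η * k := by push_cast; ring
    rw [e, Real.rpow_add (by norm_num)]
    have := mul_le_mul_of_nonneg_left ih (show 0 ≤ (2 : ℝ) ^ η by positivity)
    linarith

/-- Each rounding adds at most one, later magnified by at most `2 ^ (η * k)`. The linear factor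
costs only a logarithm per block in the prior. -/
theorem geomBoundary_le {η : ℝ} (hη : 0 ≤ η) (k : ℕ) :
    (geomBoundary η k : ℝ) ≤ 2 ^ (η * k) * (k + 2) := by
  induction k with
  | zero => simp [geomBoundary]
  | succ k ih =>
    refine (geomBoundary_le_mul k).trans ?_
    have e : η * ((k + 1 : ℕ) : ℝ) = η + η * k := by push_cast; ring
    have h1 : (1 : ℝ) ≤ 2 ^ (η + η * k) := Real.one_le_rpow (by norm_num) (by positivity)
    have := mul_le_mul_of_nonneg_left ih (show 0 ≤ (2 : ℝ) ^ η by positivity)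
    rw [e]
    rw [Real.rpow_add (by norm_num)] at h1 ⊢
    push_cast
    linarith

/-- The three summands are the rounding and flattening loss in the blocks, the cost of the tail
beyond about `2 ^ (η * G)`, and the description of the histogram shared among `n` letters. -/
theorem slow_redundancy_le {γ a : ℝ} {θ : ℕ → ℝ} (hγ : 0 < γ) (hθ : θ ∈ MonotoneSources)
    (h : ∀ j : ℕ, θ j = a / (((j : ℝ) + 2) * (Real.logb 2 ((j : ℝ) + 2)) ^ (2 + γ)))
    {n G N : ℕ} (hn : n ≠ 0) (hG : G ≠ 0) (hN : N ≠ 0) {η : ℝ} (hη : 0 < η)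
    (hη1 : (5 + 2 * γ) * η ≤ 1) :
    redundancy θ (histCode n) ≤
      (((2 * (((G : ℝ) + 1) / N) + ((5 + 2 * γ) * η) ^ 2) / Real.log 2 +
        (Real.logb 2 ((N : ℝ) + G + 1) + 2) * (2 / γ * (η * G) ^ (-γ)) +
        (3 + G * (1 + 2 * (η * G + Real.logb 2 ((G : ℝ) + 2)) + 2 * Real.logb 2 ((N : ℝ) + 2))) / n
        : ℝ) : EReal) := by
  have hlog : 0 < Real.log 2 := Real.log_pos (by norm_num)
  have hG0 : (0 : ℝ) < G := by positivity
  -- The shift by 2 matches the denominator `j + 2`, so that block ratios are those of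
  -- `geomBoundary`.
  set b : ℕ → ℕ := fun k => geomBoundary η k - 2 with hb
  have hbe : ∀ k, b k + 2 = geomBoundary η k := fun k =>
    Nat.sub_add_cancel (two_le_geomBoundary hη.le k)
  have hbe' : ∀ k, (b k : ℝ) + 2 = geomBoundary η k := fun k => by
    rw [← hbe k]; push_cast; ring
  have hmono : StrictMono b := fun i j hij => by
    have := geomBoundary_strictMono hη.le hij
    rw [← hbe i, ← hbe j] at this
    omega
  have hb0 : b 0 = 0 := rfl
  have hgrow : (2 : ℝ) ^ (η * G) ≤ (b G : ℝ) + 1 := by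
    have h1 := le_geomBoundary (η := η) G
    rw [← hbe' G] at h1
    have h2 : (1 : ℝ) ≤ 2 ^ (η * G) := Real.one_le_rpow (by norm_num) (by positivity)
    linarith
  have hbG : b G ≠ 0 := by
    have := hmono (Nat.pos_of_ne_zero hG)
    omega
  have hratio : ∀ k < G, ∀ i ∈ Finset.Ico (b k) (b (k + 1)),
      ∀ j ∈ Finset.Ico (b k) (b (k + 1)), θ i ≤ (1 + (5 + 2 * γ) * η) * θ j := by
    intro k _ i hi j hj
    rw [Finset.mem_Ico] at hi hj
    refine slow_ratio hγ hθ h hη.le hη1 ?_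
    have h1 := geomBoundary_le_mul (η := η) k
    rw [← hbe', ← hbe'] at h1
    have h2 : (j : ℝ) + 1 ≤ b (k + 1) := by exact_mod_cast hj.2
    have h3 : (b k : ℝ) ≤ i := by exact_mod_cast hi.1
    have h4 : (2 : ℝ) ^ η * ((b k : ℝ) + 2) ≤ 2 ^ η * ((i : ℝ) + 2) := by gcongr
    linarith
  have hA : 0 ≤ Real.logb 2 ((N : ℝ) + G + 1) :=
    Real.logb_nonneg (by norm_num) (by
      have : (0 : ℝ) ≤ N := by positivity
      linarith)
  have hcross := crossEntropy_le_of_summable hθ hmono hb0 hN (G := G) (by positivity) hη1 hratio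
    (slow_summable hγ hθ h) (C := Real.logb 2 ((N : ℝ) + G + 1) + 2) (by linarith) (by
      intro j _
      have := mul_le_mul_of_nonneg_left (one_le_logb_add_two j) hA
      linarith)
  have htail : ∑' j : ℕ, θ (j + b G) * Real.logb 2 (((j + b G : ℕ) : ℝ) + 2) ≤
      2 / γ * (η * G) ^ (-γ) := by
    refine (slow_tail_le hγ hθ h hbG).trans ?_
    gcongr 2 / γ * ?_
    refine Real.rpow_le_rpow_of_nonpos (by positivity) ?_ (by linarith)
    rwa [Real.le_logb_iff_rpow_le (by norm_num) (by positivity)]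
  have hprior := neg_logb_histPrior_blockList_le hmono (blockCount θ b N) (s := 0) (g := G)
    (W := 2 ^ (η * G) * ((G : ℝ) + 2)) (V := (N : ℝ) + 2) (by
      intro k hk
      refine le_trans ?_ (geomBoundary_le hη.le G)
      have h1 : b (k + 1) ≤ b G := hmono.monotone (by omega)
      have h2 : (b (k + 1) : ℝ) ≤ b G := by exact_mod_cast h1
      have h3 : (0 : ℝ) ≤ b k := by positivity
      rw [← hbe' G]
      linarith) (by
      intro k _
      have h1 := blockCount_le hθ.1 b N k
      have h2 := mul_le_mul_of_nonneg_left
        (sum_le_one_of_mem hθ (Finset.Ico (b k) (b (k + 1)))) (Nat.cast_nonneg (α := ℝ) N)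
      linarith)
  rw [Real.logb_mul (by positivity) (by positivity), Real.logb_rpow (by norm_num) (by norm_num)]
    at hprior
  have hT0 : 0 ≤ ∑' j : ℕ, θ (j + b G) * Real.logb 2 (((j + b G : ℕ) : ℝ) + 2) :=
    tsum_nonneg fun j => slow_mul_logb_nonneg hθ _
  refine redundancy_histCode_le hθ hn (by positivity) hcross ?_
  refine add_le_add (add_le_add le_rfl (mul_le_mul_of_nonneg_left htail (by linarith))) ?_
  gcongr
  linarith

/-- With the parameters `η = n ^ (-γ p)`, `G = ⌈n ^ ((2 + γ) p)⌉`, `N = n²`, `p = 1 / (3 γ + 4)`, the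
redundancy has the order `n ^ ((γ + 4) p) log n / n`. -/
theorem slow_redundancy_le_order {γ : ℝ} (hγ : 0 < γ) : ∃ K : ℝ, ∀ θ ∈ MonotoneSources,
    IsSlowSource γ θ → ∀ᶠ n : ℕ in atTop, redundancy θ (histCode n) ≤
      ((K * ((n : ℝ) ^ ((γ + 4) / (3 * γ + 4)) * Real.logb 2 n) / n : ℝ) : EReal) := by
  refine ⟨(6 + (5 + 2 * γ) ^ 2) / Real.log 2 + 12 / γ + 33, ?_⟩
  rintro θ hθ ⟨a, h⟩
  set p : ℝ := 1 / (3 * γ + 4) with hp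
  have hp0 : 0 < p := by positivity
  have hp1 : (3 * γ + 4) * p = 1 := by rw [hp]; field_simp
  have hη1 : ∀ᶠ n : ℕ in atTop, (5 + 2 * γ) * (n : ℝ) ^ (-(γ * p)) < 1 := by
    have := ((tendsto_rpow_neg_atTop (show 0 < γ * p by positivity)).comp
      tendsto_natCast_atTop_atTop).const_mul (5 + 2 * γ)
    rw [mul_zero] at this
    exact this.eventually (gt_mem_nhds one_pos)
  filter_upwards [hη1, eventually_ge_atTop 4] with n hn hn4
  have hn4' : (4 : ℝ) ≤ n := by exact_mod_cast hn4
  have hn0 : (0 : ℝ) < n := by linarith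
  have hn1 : (1 : ℝ) ≤ n := by linarith
  have hx : (γ + 4) / (3 * γ + 4) = (γ + 4) * p := by rw [hp]; ring
  rw [hx]
  set η : ℝ := (n : ℝ) ^ (-(γ * p)) with hηdef
  set g : ℝ := (n : ℝ) ^ ((2 + γ) * p) with hg
  set G : ℕ := ⌈g⌉₊ with hGdef
  set Λ : ℝ := (n : ℝ) ^ (2 * p) with hΛ
  set Y : ℝ := (n : ℝ) ^ ((γ + 4) * p) with hY
  set ℓ : ℝ := Real.logb 2 n with hℓ
  have hη0 : 0 < η := by positivity
  have hg1 : 1 ≤ g := Real.one_le_rpow hn1 (by positivity)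
  have hΛ1 : 1 ≤ Λ := Real.one_le_rpow hn1 (by positivity)
  have hY1 : 1 ≤ Y := Real.one_le_rpow hn1 (by positivity)
  have hgn : g ≤ n := by
    conv_rhs => rw [← Real.rpow_one (n : ℝ)]
    exact Real.rpow_le_rpow_of_exponent_le hn1 (by
      have := mul_le_mul_of_nonneg_right (show 2 + γ ≤ 3 * γ + 4 by linarith) hp0.le
      linarith)
  have hℓ1 : 1 ≤ ℓ := by
    rw [hℓ, Real.le_logb_iff_rpow_le (by norm_num) hn0, Real.rpow_one]; linarith
  have hgG : g ≤ G := Nat.le_ceil g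
  have hG2 : (G : ℝ) ≤ 2 * g := by
    have := (Nat.ceil_lt_add_one (by linarith : 0 ≤ g)).le
    linarith
  have hG0 : G ≠ 0 := by
    rintro h0
    rw [h0, Nat.cast_zero] at hgG
    linarith
  have hηg : η * g = Λ := by
    rw [hηdef, hg, hΛ, ← Real.rpow_add hn0]; congr 1; ring
  have hgΛ : g * Λ = Y := by
    rw [hg, hΛ, hY, ← Real.rpow_add hn0]; congr 1; ring
  -- The balance of the three costs: `η ^ 2`, `Λ ^ (-γ)` and `g * Λ / n` all equal `Y / n`, by `(3 *
  -- γ + 4) * p = 1`.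
  have hnη : n * η ^ 2 = Y := by
    rw [hηdef, hY, ← Real.rpow_natCast, ← Real.rpow_mul hn0.le]
    nth_rewrite 1 [← Real.rpow_one (n : ℝ)]
    rw [← Real.rpow_add hn0]
    congr 1
    push_cast
    linear_combination -hp1
  have hnΛ : n * Λ ^ (-γ) = Y := by
    rw [hΛ, hY, ← Real.rpow_mul hn0.le]
    nth_rewrite 1 [← Real.rpow_one (n : ℝ)]
    rw [← Real.rpow_add hn0]
    congr 1
    linear_combination -hp1
  have hΛG : Λ ≤ η * G := by rw [← hηg]; gcongr
  have hΛG2 : η * G ≤ 2 * Λ := by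
    rw [← hηg]
    have := mul_le_mul_of_nonneg_left hG2 hη0.le
    linarith
  have hpow : ∀ (k : ℕ) (x : ℝ), 0 < x → x ≤ (n : ℝ) ^ k → Real.logb 2 x ≤ k * ℓ := by
    intro k x hx0 hxk
    rw [hℓ, ← Real.logb_pow]
    exact Real.logb_le_logb_of_le (by norm_num) hx0 hxk
  have hN1 : Real.logb 2 (((n ^ 2 : ℕ) : ℝ) + G + 1) ≤ 4 * ℓ := by
    refine hpow 4 _ (by positivity) ?_
    push_cast
    nlinarith [mul_le_mul hn4' hn4' (by norm_num) hn0.le]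
  have hN2 : Real.logb 2 (((n ^ 2 : ℕ) : ℝ) + 2) ≤ 3 * ℓ := by
    refine hpow 3 _ (by positivity) ?_
    push_cast
    nlinarith [mul_le_mul hn4' hn4' (by norm_num) hn0.le]
  have hG3 : Real.logb 2 ((G : ℝ) + 2) ≤ 2 * ℓ := by
    refine hpow 2 _ (by positivity) ?_
    nlinarith
  have hlog : 0 < Real.log 2 := Real.log_pos (by norm_num)
  refine (slow_redundancy_le hγ hθ h (n := n) (G := G) (N := n ^ 2) (by omega) hG0
    (by positivity) hη0 hn.le).trans (EReal.coe_le_coe_iff.2 ?_)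
  have hYℓ : Y ≤ Y * ℓ := le_mul_of_one_le_right (by linarith) hℓ1
  have t1 : (2 * (((G : ℝ) + 1) / ((n ^ 2 : ℕ) : ℝ)) + ((5 + 2 * γ) * η) ^ 2) / Real.log 2 ≤
      (6 + (5 + 2 * γ) ^ 2) / Real.log 2 * (Y * ℓ) / n := by
    rw [div_mul_eq_mul_div, div_right_comm]
    gcongr
    rw [le_div_iff₀ hn0]
    have e1 : (2 * (((G : ℝ) + 1) / ((n ^ 2 : ℕ) : ℝ)) + ((5 + 2 * γ) * η) ^ 2) * n =
        2 * (((G : ℝ) + 1) / n) + (5 + 2 * γ) ^ 2 * (n * η ^ 2) := by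
      push_cast
      field_simp
    rw [e1, hnη]
    -- The choice `N = n ^ 2` keeps `n` times the rounding loss bounded, while `log N` remains of
    -- order `log n`.
    have e2 : ((G : ℝ) + 1) / n ≤ 3 := by
      rw [div_le_iff₀ hn0]; linarith
    have e3 := mul_le_mul_of_nonneg_left hYℓ (show 0 ≤ (5 + 2 * γ) ^ 2 by positivity)
    linarith
  have t2 : (Real.logb 2 (((n ^ 2 : ℕ) : ℝ) + G + 1) + 2) * (2 / γ * (η * G) ^ (-γ)) ≤
      12 / γ * (Y * ℓ) / n := by
    have e1 : (η * G) ^ (-γ) ≤ Λ ^ (-γ) :=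
      Real.rpow_le_rpow_of_nonpos (by linarith) hΛG (by linarith)
    have e2 : Λ ^ (-γ) = Y / n := by
      rw [← hnΛ]; field_simp
    calc _ ≤ (6 * ℓ) * (2 / γ * (Y / n)) := by
          rw [← e2]
          gcongr
          linarith
      _ = _ := by ring
  have t3 : (3 + G * (1 + 2 * (η * G + Real.logb 2 ((G : ℝ) + 2)) +
      2 * Real.logb 2 (((n ^ 2 : ℕ) : ℝ) + 2))) / n ≤ 33 * (Y * ℓ) / n := by
    gcongr
    have e1 : 1 + 2 * (η * G + Real.logb 2 ((G : ℝ) + 2)) +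
        2 * Real.logb 2 (((n ^ 2 : ℕ) : ℝ) + 2) ≤ 15 * (Λ * ℓ) := by
      have := le_mul_of_one_le_right (zero_le_one.trans hΛ1) hℓ1
      have := le_mul_of_one_le_left (zero_le_one.trans hℓ1) hΛ1
      linarith
    have e2 : (G : ℝ) * (1 + 2 * (η * G + Real.logb 2 ((G : ℝ) + 2)) +
        2 * Real.logb 2 (((n ^ 2 : ℕ) : ℝ) + 2)) ≤ 2 * g * (15 * (Λ * ℓ)) := by
      refine (mul_le_mul_of_nonneg_left e1 (Nat.cast_nonneg G)).trans ?_
      exact mul_le_mul_of_nonneg_right hG2 (by positivity)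
    have e3 : 2 * g * (15 * (Λ * ℓ)) = 30 * (Y * ℓ) := by rw [← hgΛ]; ring
    linarith
  refine (add_le_add (add_le_add t1 t2) t3).trans (le_of_eq ?_)
  ring

end MonotoneCoding

/-! ### Conclusion. -/

theorem mainTheorem12 :
    ∃ C : (n : ℕ) → MonotoneCoding.PrefixCode n,
      MonotoneCoding.IsUniversal C ∧
      ∀ γ : ℝ, 0 < γ → ∀ θ ∈ MonotoneCoding.MonotoneSources, MonotoneCoding.IsSlowSource γ θ →
        MonotoneCoding.entropy θ ≠ ⊤ ∧
        ∀ ε : ℝ, 0 < ε → ∀ᶠ n : ℕ in atTop,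
          MonotoneCoding.redundancy θ (C n) ≤
            (((1 + ε) * ((n : ℝ) ^ ((γ + 4) / (3 * γ + 4)) * (Real.logb 2 (n : ℝ)) ^ 2)
              / (2 * (n : ℝ)) : ℝ) : EReal) := by
  refine ⟨MonotoneCoding.histCode, MonotoneCoding.isUniversal_histCode,
    fun γ hγ θ hθ hslow => ⟨?_, fun ε hε => ?_⟩⟩
  · obtain ⟨a, h⟩ := hslow
    exact MonotoneCoding.slow_entropy_ne_top hγ hθ h
  · obtain ⟨K, hK⟩ := MonotoneCoding.slow_redundancy_le_order hγ
    have hlog : Tendsto (fun n : ℕ => Real.logb 2 (n : ℝ)) atTop atTop :=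
      (Real.tendsto_logb_atTop (by norm_num)).comp tendsto_natCast_atTop_atTop
    -- The spare logarithm pays for both `K` and the factor `1 / 2` once `log n ≥ 2 * K`.
    filter_upwards [hK θ hθ hslow, hlog.eventually_ge_atTop (2 * K), eventually_ge_atTop 1]
      with n hn hKn hn1
    refine hn.trans (EReal.coe_le_coe_iff.2 ?_)
    have hn0 : (1 : ℝ) ≤ n := by exact_mod_cast hn1
    have hn0' : (0 : ℝ) < n := by linarith
    have hℓ : 0 ≤ Real.logb 2 (n : ℝ) := Real.logb_nonneg (by norm_num) hn0
    rw [← div_div]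
    gcongr
    have h1 : 0 ≤ (n : ℝ) ^ ((γ + 4) / (3 * γ + 4)) * Real.logb 2 (n : ℝ) := by positivity
    have h2 : K ≤ (1 + ε) * Real.logb 2 (n : ℝ) / 2 := by
      have := mul_nonneg hε.le hℓ
      linarith
    refine (mul_le_mul_of_nonneg_right h2 h1).trans (le_of_eq ?_)
    ring
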